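/- Let $L\subset\mathbb R^n$ be a smooth embedded $p$-dimensional submanifold, put $q=n-p$, and let $\mu$ be a smooth closed $1$-form on $L$. Regard $\mu_x\in T_x^*L$ as an element of $T_x^*\mathbb R^n$ by extending it by zero on the normal space, and let $$X_\mu=\{(x,\xi+\mu_x):\ x\in L,\ \xi\in N_x^*L\}\subset T^*\mathbb R^n\cong\mathbb C^n,\qquad (x,\xi)\mapsto (x_j+i\xi_j)_j,$$ where $N_x^*L\subset T_x^*\mathbb R^n$ is the space of covectors that vanish on $T_xL$. Let $\nabla$ be the Levi-Civita connection of $\mathbb R^n$. For a smooth normal vector field $\nu$ on $L$ let $A^\nu(w)=(\nabla_w\nu)^T$ for $w\in T_xL$. For an orthonormal basis $e_1,\dots,e_p$ of $T_xL$ write $A^\nu$ also for the matrix $\langle A^\nu(e_i),e_j\rangle$, and let $B$ be the matrix $$B_{ij}=\tfrac12\big((\nabla_{e_i}\mu)(e_j)+(\nabla_{e_j}\mu)(e_i)\big).$$ For a $p\times p$ matrix $C$ let $\sigma_j(C)$ be the coefficient of $t^j$ in $\det(I+tC)$. An $n$-dimensional submanifold $X$ of $\mathbb C^n$ is Lagrangian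 if $\omega=\sum_j dx_j\wedge dy_j$ vanishes on it, and special Lagrangian with phase $e^{i\theta}$ if moreover $\operatorname{Im}(e^{-i\theta}\,dz_1\wedge\dots\wedge dz_n)$ vanishes on it. Then $X_\mu$ is a Lagrangian submanifold, $B_{ij}=(\nabla_{e_i}\mu)(e_j)$ at every $x \in L$, and, for every $\theta\in\mathbb R$, with $\phi=\frac{\pi}{2}q-\theta$, $X_\mu$ is special Lagrangian with phase $e^{i\theta}$ if and only if at every point $x\in L$ and for every orthonormal basis of $T_xL$ $$\operatorname{Im}\big(e^{i\phi}\det(I+iB)\big)=0$$ and $$\sigma_j\big(A^\nu(I+iB)^{-1}\big)=(-1)^j\,\sigma_j\big(A^\nu(I-iB)^{-1}\big)\quad\text{for all } j=1,\dots,p \text{ and every smooth normal vector field } \nu \text{ on } L.$$ -/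

import Mathlib

open scoped ContDiff

noncomputable section

/-! ### Submanifolds of a normed space, tangent spaces, smooth maps on them -/

section Submanifold

variable {F : Type*} [NormedAddCommGroup F] [NormedSpace ℝ F]

/-- `S` is a (smooth, embedded, without boundary) `k`-dimensional submanifold of `F`: around each of
its points there is a smooth diffeomorphism between open sets of `F` that carries `S` onto an open
piece of a `k`-dimensional linear subspace. -/
def IsSmoothSubmanifold (k : ℕ) (S : Set F) : Prop :=
  ∀ x ∈ S, ∃ Φ : OpenPartialHomeomorph F F, x ∈ Φ.source ∧
    ContDiffOn ℝ ∞ Φ Φ.source ∧ ContDiffOn ℝ ∞ Φ.symm Φ.target ∧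
    ∃ W : Submodule ℝ F, FiniteDimensional ℝ W ∧ Module.finrank ℝ W = k ∧
      Φ '' (S ∩ Φ.source) = (W : Set F) ∩ Φ.target

/-- The tangent space `T_x S`, as a linear subspace of the ambient space: the span of all limits of
rescaled secant vectors of `S` at `x`.  (For a submanifold these limits already are the linear
space of velocities at `x` of the curves in `S`.) -/
def tangentSpaceAt (S : Set F) (x : F) : Submodule ℝ F :=
  Submodule.span ℝ (tangentConeAt ℝ S x)

/-- `f` is smooth as a map on the subset `S`: near each point of `S` it agrees on `S` with a smooth
map defined on an open set of the ambient space. -/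
def SmoothAlong {G : Type*} [NormedAddCommGroup G] [NormedSpace ℝ G] (S : Set F) (f : F → G) :
    Prop :=
  ∀ x ∈ S, ∃ (U : Set F) (g : F → G), IsOpen U ∧ x ∈ U ∧ ContDiffOn ℝ ∞ g U ∧
    ∀ y ∈ S ∩ U, f y = g y

/-- The derivative `D_w f` at `x` of a map `f` defined along `S`, in the direction of a tangent
vector `w ∈ T_x S`, i.e. the covariant derivative `∇_w f` for the flat Levi-Civita connection of the
ambient space.  For `x ∈ S`, `w ∈ T_x S` and `f` smooth along `S` it depends only on the
restriction of `f` to `S`: it is `Dg(x) w` for any smooth extension `g` of `f` near `x`. -/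
def derivAlong {G : Type*} [NormedAddCommGroup G] [NormedSpace ℝ G] (S : Set F) (f : F → G)
    (x w : F) : G :=
  fderivWithin ℝ f S x w

end Submanifold

/-! ### Differential 1-forms, normal fields and second fundamental form of `L ⊆ ℝⁿ` -/

section Euclidean

variable {n : ℕ}

/-- A (not yet smooth) 1-form on `L ⊆ ℝⁿ`: a section `x ↦ μ_x ∈ T_x^* L` of the cotangent bundle
of `L`. -/
abbrev OneFormOn (L : Set (EuclideanSpace ℝ (Fin n))) : Type :=
  (x : L) → (tangentSpaceAt L (x : EuclideanSpace ℝ (Fin n)) →L[ℝ] ℝ)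

open Classical in
/-- A 1-form on `L` as a section of `T^*ℝⁿ` over `L`, through the orthogonal inclusion of `T_x^* L`
in `T_x^* ℝⁿ`: extend `μ_x` by zero on the normal space.  (The value away from `L` is irrelevant.) -/
def OneFormOn.ambient {L : Set (EuclideanSpace ℝ (Fin n))} (μ : OneFormOn L)
    (x : EuclideanSpace ℝ (Fin n)) : EuclideanSpace ℝ (Fin n) →L[ℝ] ℝ :=
  if hx : x ∈ L then (μ ⟨x, hx⟩).comp (tangentSpaceAt L x).orthogonalProjectionOnto else 0

/-- `μ` is a smooth 1-form on `L`. -/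
def OneFormOn.IsSmooth {L : Set (EuclideanSpace ℝ (Fin n))} (μ : OneFormOn L) : Prop :=
  SmoothAlong L μ.ambient

/-- `dμ = 0` on `L`.  If `η` is a smooth 1-form on an open set `U` of `ℝⁿ` with `ι^*η = μ` on
`L ∩ U`, where `ι` is the inclusion of `L`, then `dμ = ι^*(dη)` on `L ∩ U`; this has to vanish. -/
def OneFormOn.IsClosedForm {L : Set (EuclideanSpace ℝ (Fin n))} (μ : OneFormOn L) : Prop :=
  ∀ (U : Set (EuclideanSpace ℝ (Fin n)))
    (η : EuclideanSpace ℝ (Fin n) → EuclideanSpace ℝ (Fin n) [⋀^Fin 1]→L[ℝ] ℝ),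
    IsOpen U → ContDiffOn ℝ ∞ η U →
    (∀ y : L, (y : EuclideanSpace ℝ (Fin n)) ∈ U →
      ∀ v : tangentSpaceAt L (y : EuclideanSpace ℝ (Fin n)), η y ![(v : _)] = μ y v) →
    ∀ x ∈ L ∩ U, ∀ v ∈ tangentSpaceAt L x, ∀ w ∈ tangentSpaceAt L x,
      extDeriv η x ![v, w] = 0

/-- `ν` is a smooth normal vector field on `L`. -/
def IsNormalField (L : Set (EuclideanSpace ℝ (Fin n)))
    (ν : EuclideanSpace ℝ (Fin n) → EuclideanSpace ℝ (Fin n)) : Prop :=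
  SmoothAlong L ν ∧ ∀ x ∈ L, ν x ∈ (tangentSpaceAt L x)ᗮ

/-- The second fundamental form in the direction of the normal field `ν`, with the sign convention
`A^ν(w) = (∇_w ν)^T`, for `w ∈ T_x L`. -/
def secondFundamentalForm (L : Set (EuclideanSpace ℝ (Fin n)))
    (ν : EuclideanSpace ℝ (Fin n) → EuclideanSpace ℝ (Fin n)) (x w : EuclideanSpace ℝ (Fin n)) :
    tangentSpaceAt L x :=
  (tangentSpaceAt L x).orthogonalProjectionOnto (derivAlong L ν x w)

/-- The matrix `A_{ij} = ⟨A^ν(e_i), e_j⟩` in an orthonormal basis of `T_x L`. -/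
def secondFundamentalMatrix {p : ℕ} (L : Set (EuclideanSpace ℝ (Fin n)))
    (ν : EuclideanSpace ℝ (Fin n) → EuclideanSpace ℝ (Fin n)) {x : EuclideanSpace ℝ (Fin n)}
    (e : OrthonormalBasis (Fin p) ℝ (tangentSpaceAt L x)) : Matrix (Fin p) (Fin p) ℝ :=
  Matrix.of fun i j => inner ℝ (secondFundamentalForm L ν x (e i)) (e j)

/-- The covariant derivative `(∇_v μ)(w)` of a 1-form on `L`. -/
def OneFormOn.covDeriv {L : Set (EuclideanSpace ℝ (Fin n))} (μ : OneFormOn L)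
    (x v w : EuclideanSpace ℝ (Fin n)) : ℝ :=
  derivAlong L μ.ambient x v w

/-- The matrix `B_{ij} = ½ ((∇_{e_i} μ)(e_j) + (∇_{e_j} μ)(e_i))` of the symmetrized covariant
derivative of `μ` in an orthonormal basis of `T_x L`. -/
def OneFormOn.symCovDerivMatrix {p : ℕ} {L : Set (EuclideanSpace ℝ (Fin n))} (μ : OneFormOn L)
    {x : EuclideanSpace ℝ (Fin n)} (e : OrthonormalBasis (Fin p) ℝ (tangentSpaceAt L x)) :
    Matrix (Fin p) (Fin p) ℝ :=
  Matrix.of fun i j => (μ.covDeriv x (e i) (e j) + μ.covDeriv x (e j) (e i)) / 2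

/-! ### The twisted conormal bundle -/

/-- The fibre `N_x^* L ⊆ T_x^* ℝⁿ` of the conormal bundle: the covectors that vanish on `T_x L`. -/
def conormalSpaceAt (L : Set (EuclideanSpace ℝ (Fin n))) (x : EuclideanSpace ℝ (Fin n)) :
    Set (EuclideanSpace ℝ (Fin n) →L[ℝ] ℝ) :=
  {ξ | ∀ v ∈ tangentSpaceAt L x, ξ v = 0}

/-- `{(x, ξ + μ_x) : x ∈ L, ξ ∈ N_x^* L}`, as a subset of `T^*ℝⁿ = ℝⁿ × (ℝⁿ)^*`. -/
def twistedConormal {L : Set (EuclideanSpace ℝ (Fin n))} (μ : OneFormOn L) :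
    Set (EuclideanSpace ℝ (Fin n) × (EuclideanSpace ℝ (Fin n) →L[ℝ] ℝ)) :=
  {a | a.1 ∈ L ∧ ∃ ξ ∈ conormalSpaceAt L a.1, a.2 = ξ + μ.ambient a.1}

/-- The identification `T^*ℝⁿ ≅ ℂⁿ`, `(x, ξ) ↦ z` with `z_j = x_j + i ξ_j`. -/
def cotangentToComplex (a : EuclideanSpace ℝ (Fin n) × (EuclideanSpace ℝ (Fin n) →L[ℝ] ℝ)) :
    EuclideanSpace ℂ (Fin n) :=
  WithLp.toLp 2 fun j =>
    ((a.1 j : ℝ) : ℂ) + Complex.I * ((a.2 (EuclideanSpace.single j 1) : ℝ) : ℂ)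

/-- `X_μ = N^*L + μ` as a subset of `ℂⁿ`. -/
def twistedConormalComplex {L : Set (EuclideanSpace ℝ (Fin n))} (μ : OneFormOn L) :
    Set (EuclideanSpace ℂ (Fin n)) :=
  cotangentToComplex '' twistedConormal μ

/-! ### Special Lagrangian submanifolds of `ℂⁿ` -/

/-- The symplectic form `ω = ∑ dx_j ∧ dy_j` on `ℂⁿ`. -/
def kahlerForm (u v : EuclideanSpace ℂ (Fin n)) : ℝ :=
  ∑ j, ((u j).re * (v j).im - (u j).im * (v j).re)

/-- The holomorphic volume form `Ω = dz_1 ∧ ⋯ ∧ dz_n` on `ℂⁿ`. -/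
def holomorphicVolumeForm (v : Fin n → EuclideanSpace ℂ (Fin n)) : ℂ :=
  Matrix.det (Matrix.of fun i j => v i j)

/-- `X` is a Lagrangian submanifold of `ℂⁿ`: an `n`-dimensional submanifold with `ω|_X = 0`. -/
def IsLagrangian (X : Set (EuclideanSpace ℂ (Fin n))) : Prop :=
  IsSmoothSubmanifold n X ∧
    ∀ z ∈ X, ∀ u ∈ tangentSpaceAt X z, ∀ v ∈ tangentSpaceAt X z, kahlerForm u v = 0

/-- `X` is a special Lagrangian submanifold of `ℂⁿ` with phase `e^{iθ}`: it is Lagrangian and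
`Im(e^{-iθ} Ω)|_X = 0`. -/
def IsSpecialLagrangian (θ : ℝ) (X : Set (EuclideanSpace ℂ (Fin n))) : Prop :=
  IsLagrangian X ∧
    ∀ z ∈ X, ∀ v : Fin n → EuclideanSpace ℂ (Fin n), (∀ i, v i ∈ tangentSpaceAt X z) →
      (Complex.exp (-(θ * Complex.I)) * holomorphicVolumeForm v).im = 0

end Euclidean

/-- The elementary symmetric polynomial `σ_k(A)` of a square matrix, the coefficient of `t^k` in
`det(I + t A)`. -/
def matrixSigma {p : ℕ} (k : ℕ) (A : Matrix (Fin p) (Fin p) ℂ) : ℂ :=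
  (Matrix.det (1 + (Polynomial.X : Polynomial ℂ) • A.map Polynomial.C)).coeff k

/-- The complex matrix `I + c B`, for a real matrix `B` and `c ∈ ℂ`. -/
def onePlus {p : ℕ} (c : ℂ) (B : Matrix (Fin p) (Fin p) ℝ) : Matrix (Fin p) (Fin p) ℂ :=
  1 + c • B.map Complex.ofReal

end

/-! Every point of `X_μ` over `x` is `(x, ν_x + μ_x)` for some normal field `ν`. With `e` and `f`
orthonormal frames of the tangent and normal spaces of `L`, the tangent space there is spanned by
the vectors `(e_i, ∇_{e_i}(ν + μ))` and `(0, f_k)` (`mem_tangentSpaceAt_twistedConormal_iff`). Near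
`x`, `ν + μ` extends to a 1-form that restricts to `μ` on `L`, because `ν` kills tangent vectors.
Closedness of `μ` therefore makes its tangential derivative `A^ν + B` symmetric, and this symmetry
is the Lagrangian condition.

Pairing the tangent frame with the orthonormal frame `(e, f)` gives a block triangular matrix with
diagonal blocks `I + i(A^ν + B)` and `i I`. Up to a nonzero real factor, `Ω` on the frame is thus
`i^q det(I + i(A^ν + B))` (`exists_holomorphicVolumeForm_twistedFrame`), and the phase condition
reads `Im(e^{iφ} det(I + i(A^ν + B))) = 0` for all `ν`.

Replacing `ν` by `tν` turns this into a condition on the polynomial `det(I + iB) det(I + itA(I +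
iB)⁻¹)` in the real variable `t`, whose second factor has coefficients `i^j σ_j`. The constant term
is the condition on `B`. Once it holds, `e^{iφ} det(I + iB)` is a nonzero real number, and the other
coefficients say that each `i^j σ_j` is real, which is the condition on `σ_j`
(`forall_im_det_onePlus_eq_zero_iff`). -/

noncomputable section

/-! ### Slice charts, tangent spaces and derivatives along a submanifold. -/

section SliceChart

variable {F : Type*} [NormedAddCommGroup F] [NormedSpace ℝ F]

/-- `Φ` is a smooth diffeomorphism between open sets that straightens `S` to the linear
subspace `W`. -/
structure IsSliceChart (S : Set F) (Φ : OpenPartialHomeomorph F F) (W : Submodule ℝ F) : Prop where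
  contDiffOn : ContDiffOn ℝ ∞ Φ Φ.source
  contDiffOn_symm : ContDiffOn ℝ ∞ Φ.symm Φ.target
  image_eq : Φ '' (S ∩ Φ.source) = (W : Set F) ∩ Φ.target

namespace IsSliceChart

variable {S : Set F} {Φ : OpenPartialHomeomorph F F} {W : Submodule ℝ F} {x : F}

theorem contDiffAt (h : IsSliceChart S Φ W) (hx : x ∈ Φ.source) : ContDiffAt ℝ ∞ Φ x :=
  h.contDiffOn.contDiffAt (Φ.open_source.mem_nhds hx)

theorem contDiffAt_symm (h : IsSliceChart S Φ W) (hx : x ∈ Φ.target) :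
    ContDiffAt ℝ ∞ Φ.symm x :=
  h.contDiffOn_symm.contDiffAt (Φ.open_target.mem_nhds hx)

theorem hasFDerivAt (h : IsSliceChart S Φ W) (hx : x ∈ Φ.source) :
    HasFDerivAt Φ (fderiv ℝ Φ x) x :=
  ((h.contDiffAt hx).differentiableAt (by simp)).hasFDerivAt

theorem hasFDerivAt_symm (h : IsSliceChart S Φ W) (hx : x ∈ Φ.target) :
    HasFDerivAt Φ.symm (fderiv ℝ Φ.symm x) x :=
  ((h.contDiffAt_symm hx).differentiableAt (by simp)).hasFDerivAt

theorem fderiv_symm_comp_fderiv (h : IsSliceChart S Φ W) (hx : x ∈ Φ.source) :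
    (fderiv ℝ Φ.symm (Φ x)).comp (fderiv ℝ Φ x) = ContinuousLinearMap.id ℝ F := by
  refine ((h.hasFDerivAt_symm (Φ.map_source hx)).comp x (h.hasFDerivAt hx)).unique ?_
  refine (hasFDerivAt_id x).congr_of_eventuallyEq ?_
  filter_upwards [Φ.open_source.mem_nhds hx] with y hy
  simp [Φ.left_inv hy]

theorem fderiv_comp_fderiv_symm (h : IsSliceChart S Φ W) (hx : x ∈ Φ.source) :
    (fderiv ℝ Φ x).comp (fderiv ℝ Φ.symm (Φ x)) = ContinuousLinearMap.id ℝ F := by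
  have h1 : HasFDerivAt Φ (fderiv ℝ Φ x) (Φ.symm (Φ x)) := by
    rw [Φ.left_inv hx]; exact h.hasFDerivAt hx
  refine (h1.comp (Φ x) (h.hasFDerivAt_symm (Φ.map_source hx))).unique ?_
  refine (hasFDerivAt_id (Φ x)).congr_of_eventuallyEq ?_
  filter_upwards [Φ.open_target.mem_nhds (Φ.map_source hx)] with y hy
  simp [Φ.right_inv hy]

/-- The derivative of a slice chart, as a linear equivalence. -/
def fderivEquiv (h : IsSliceChart S Φ W) (hx : x ∈ Φ.source) : F ≃L[ℝ] F :=
  ContinuousLinearEquiv.equivOfInverse (fderiv ℝ Φ x) (fderiv ℝ Φ.symm (Φ x))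
    (fun v => DFunLike.congr_fun (h.fderiv_symm_comp_fderiv hx) v)
    (fun v => DFunLike.congr_fun (h.fderiv_comp_fderiv_symm hx) v)

theorem apply_mem (h : IsSliceChart S Φ W) (hx : x ∈ S ∩ Φ.source) : Φ x ∈ W :=
  (h.image_eq.subset ⟨x, hx, rfl⟩).1

theorem symm_apply_mem (h : IsSliceChart S Φ W) {y : F} (hy : y ∈ (W : Set F) ∩ Φ.target) :
    Φ.symm y ∈ S := by
  obtain ⟨x, hx, rfl⟩ := h.image_eq.superset hy
  rw [Φ.left_inv hx.2]
  exact hx.1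

theorem apply_mem_iff (h : IsSliceChart S Φ W) (hx : x ∈ Φ.source) : Φ x ∈ W ↔ x ∈ S := by
  refine ⟨fun hW => ?_, fun hS => h.apply_mem ⟨hS, hx⟩⟩
  have := h.symm_apply_mem ⟨hW, Φ.map_source hx⟩
  rwa [Φ.left_inv hx] at this

/-- Derivatives carry tangent cones to tangent cones. Rescaled secants of `W` stay in `W`, which is
closed because it is finite-dimensional, so the cone lands in `W`. Conversely, segments in `W`
realise every direction of `W`, and `Φ.symm` carries them back to `S`. -/
theorem mem_tangentSpaceAt_iff [FiniteDimensional ℝ W] (h : IsSliceChart S Φ W)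
    (hx : x ∈ S ∩ Φ.source) {v : F} : v ∈ tangentSpaceAt S x ↔ fderiv ℝ Φ x v ∈ W := by
  constructor
  · intro hv
    suffices hsub : tangentSpaceAt S x ≤ W.comap (fderiv ℝ Φ x : F →ₗ[ℝ] F) from hsub hv
    refine Submodule.span_le.2 fun u hu => ?_
    rw [← tangentConeAt_inter_nhds (Φ.open_source.mem_nhds hx.2)] at hu
    have h1 := (h.hasFDerivAt hx.2).hasFDerivWithinAt.mapsTo_tangent_cone hu
    rw [h.image_eq] at h1
    obtain ⟨ι, l, hl, c, d, -, hds, hcd⟩ := exists_fun_of_mem_tangentConeAt h1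
    refine (Submodule.closed_of_finiteDimensional W).mem_of_tendsto hcd ?_
    refine hds.mono fun k hk => W.smul_mem _ ?_
    have := W.sub_mem hk.1 (h.apply_mem hx)
    simpa using this
  · intro hv
    have h1 : fderiv ℝ Φ x v ∈ tangentConeAt ℝ ((W : Set F) ∩ Φ.target) (Φ x) := by
      rw [tangentConeAt_inter_nhds (Φ.open_target.mem_nhds (Φ.map_source hx.2))]
      have := mem_tangentConeAt_of_segment_subset (s := (W : Set F)) (x := Φ x)
        (y := Φ x + fderiv ℝ Φ x v)
        (W.convex.segment_subset (h.apply_mem hx) (W.add_mem (h.apply_mem hx) hv))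
      simpa using this
    have h2 := (h.hasFDerivAt_symm
      (Φ.map_source hx.2)).hasFDerivWithinAt.mapsTo_tangent_cone h1
    rw [Φ.left_inv hx.2, show fderiv ℝ Φ.symm (Φ x) (fderiv ℝ Φ x v) = v from
      DFunLike.congr_fun (h.fderiv_symm_comp_fderiv hx.2) v] at h2
    refine Submodule.subset_span (tangentConeAt_mono ?_ h2)
    rintro _ ⟨y, hy, rfl⟩
    exact h.symm_apply_mem hy

theorem finrank_tangentSpaceAt [FiniteDimensional ℝ W] (h : IsSliceChart S Φ W)
    (hx : x ∈ S ∩ Φ.source) : Module.finrank ℝ (tangentSpaceAt S x) = Module.finrank ℝ W := by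
  have h1 : W = (tangentSpaceAt S x).map ((h.fderivEquiv hx.2).toLinearEquiv : F →ₗ[ℝ] F) := by
    ext w
    rw [Submodule.mem_map_equiv, h.mem_tangentSpaceAt_iff hx]
    have : fderiv ℝ Φ x ((h.fderivEquiv hx.2).symm w) = w :=
      (h.fderivEquiv hx.2).apply_symm_apply w
    exact iff_of_eq (congrArg (· ∈ W) this.symm)
  conv_rhs => rw [h1]
  exact (LinearEquiv.finrank_map_eq _ _).symm

end IsSliceChart

theorem IsSmoothSubmanifold.exists_isSliceChart {k : ℕ} {S : Set F} (hS : IsSmoothSubmanifold k S)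
    {x : F} (hx : x ∈ S) : ∃ Φ W, IsSliceChart S Φ W ∧ x ∈ Φ.source ∧ FiniteDimensional ℝ W ∧
      Module.finrank ℝ W = k := by
  obtain ⟨Φ, hxs, h1, h2, W, hW, hk, h3⟩ := hS x hx
  exact ⟨Φ, W, ⟨h1, h2, h3⟩, hxs, hW, hk⟩

theorem IsSmoothSubmanifold.finrank_tangentSpaceAt {k : ℕ} {S : Set F}
    (hS : IsSmoothSubmanifold k S) {x : F} (hx : x ∈ S) :
    Module.finrank ℝ (tangentSpaceAt S x) = k := by
  obtain ⟨Φ, W, hΦ, hxs, hW, hk⟩ := hS.exists_isSliceChart hx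
  rw [hΦ.finrank_tangentSpaceAt ⟨hx, hxs⟩, hk]

theorem map_mem_tangentSpaceAt {G : Type*} [NormedAddCommGroup G] [NormedSpace ℝ G] {S U : Set F}
    {X : Set G} {f : F → G} {x v : F} (hf : DifferentiableAt ℝ f x) (hU : U ∈ nhds x)
    (hSX : ∀ y ∈ S ∩ U, f y ∈ X) (hv : v ∈ tangentSpaceAt S x) :
    fderiv ℝ f x v ∈ tangentSpaceAt X (f x) := by
  suffices hsub : tangentSpaceAt S x ≤
      (tangentSpaceAt X (f x)).comap (fderiv ℝ f x : F →ₗ[ℝ] G) from hsub hv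
  refine Submodule.span_le.2 fun u hu => ?_
  rw [← tangentConeAt_inter_nhds hU] at hu
  exact Submodule.subset_span (tangentConeAt_mono (Set.image_subset_iff.2 hSX)
    (hf.hasFDerivAt.hasFDerivWithinAt.mapsTo_tangent_cone hu))

/-- `fderivWithin` is not determined on all of `F`, since `S` is thin. Any two derivatives within
`S` agree on the tangent cone, hence on its span. -/
theorem derivAlong_eq_fderiv {G : Type*} [NormedAddCommGroup G] [NormedSpace ℝ G] {S U : Set F}
    {f g : F → G} {x v : F} (hx : x ∈ S) (hU : U ∈ nhds x) (hg : DifferentiableAt ℝ g x)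
    (hfg : ∀ y ∈ S ∩ U, f y = g y) (hv : v ∈ tangentSpaceAt S x) :
    derivAlong S f x v = fderiv ℝ g x v := by
  have h1 : HasFDerivWithinAt f (fderiv ℝ g x) S x := by
    refine hg.hasFDerivAt.hasFDerivWithinAt.congr_of_eventuallyEq ?_
      (hfg x ⟨hx, mem_of_mem_nhds hU⟩)
    filter_upwards [self_mem_nhdsWithin, mem_nhdsWithin_of_mem_nhds hU] with y h1 h2
    exact hfg y ⟨h1, h2⟩
  have h2 := h1.differentiableWithinAt.hasFDerivWithinAt.unique_on h1
  exact LinearMap.eqOn_span (f := (fderivWithin ℝ f S x : F →ₗ[ℝ] G))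
    (g := (fderiv ℝ g x : F →ₗ[ℝ] G)) h2 hv

end SliceChart

theorem Submodule.finrank_prod_eq {K V V' : Type*} [DivisionRing K] [AddCommGroup V] [Module K V]
    [AddCommGroup V'] [Module K V'] [FiniteDimensional K V] [FiniteDimensional K V']
    (S : Submodule K V) (T : Submodule K V') :
    Module.finrank K (S.prod T) = Module.finrank K S + Module.finrank K T := by
  rw [← Module.finrank_prod]
  have hinj : Function.Injective (S.subtype.prodMap T.subtype) :=
    Function.Injective.prodMap S.injective_subtype T.injective_subtype
  have hr : S.prod T = LinearMap.range (S.subtype.prodMap T.subtype) := by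
    rw [LinearMap.range_prodMap, Submodule.range_subtype, Submodule.range_subtype]
  rw [hr, LinearMap.finrank_range_of_inj hinj]

/-! ### Restriction of slice charts and transport by linear isomorphisms. -/

section Transport

variable {F F' : Type*} [NormedAddCommGroup F] [NormedSpace ℝ F]
  [NormedAddCommGroup F'] [NormedSpace ℝ F']

theorem IsSliceChart.restrOpen {S : Set F} {Φ : OpenPartialHomeomorph F F} {W : Submodule ℝ F}
    (h : IsSliceChart S Φ W) {U : Set F} (hU : IsOpen U) :
    IsSliceChart S (Φ.restrOpen U hU) W where
  contDiffOn := h.contDiffOn.mono Set.inter_subset_left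
  contDiffOn_symm := h.contDiffOn_symm.mono Set.inter_subset_left
  image_eq := by
    ext y
    constructor
    · rintro ⟨x, ⟨hxS, hx⟩, rfl⟩
      exact ⟨h.apply_mem ⟨hxS, hx.1⟩, (Φ.restrOpen U hU).map_source hx⟩
    · rintro ⟨hyW, hy⟩
      exact ⟨Φ.symm y, ⟨h.symm_apply_mem ⟨hyW, hy.1⟩, (Φ.restrOpen U hU).map_target hy⟩,
        Φ.right_inv hy.1⟩

theorem isSliceChart_of_mem_iff {S : Set F} {Φ : OpenPartialHomeomorph F F} {W : Submodule ℝ F}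
    (h1 : ContDiffOn ℝ ∞ Φ Φ.source) (h2 : ContDiffOn ℝ ∞ Φ.symm Φ.target)
    (h3 : ∀ x ∈ Φ.source, x ∈ S ↔ Φ x ∈ W) : IsSliceChart S Φ W where
  contDiffOn := h1
  contDiffOn_symm := h2
  image_eq := by
    ext y
    constructor
    · rintro ⟨x, ⟨hxS, hx⟩, rfl⟩
      exact ⟨(h3 x hx).1 hxS, Φ.map_source hx⟩
    · rintro ⟨hyW, hy⟩
      refine ⟨Φ.symm y, ⟨(h3 _ (Φ.map_target hy)).2 ?_, Φ.map_target hy⟩, Φ.right_inv hy⟩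
      rwa [Φ.right_inv hy]

theorem IsSliceChart.isSmoothSubmanifold {k : ℕ} {S : Set F}
    (h : ∀ x ∈ S, ∃ Φ W, IsSliceChart S Φ W ∧ x ∈ Φ.source ∧ FiniteDimensional ℝ W ∧
      Module.finrank ℝ W = k) : IsSmoothSubmanifold k S := by
  intro x hx
  obtain ⟨Φ, W, hΦ, hxs, hW, hk⟩ := h x hx
  exact ⟨Φ, hxs, hΦ.contDiffOn, hΦ.contDiffOn_symm, W, hW, hk, hΦ.image_eq⟩

theorem IsSmoothSubmanifold.image {k : ℕ} {S : Set F} (hS : IsSmoothSubmanifold k S)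
    (J : F ≃L[ℝ] F') : IsSmoothSubmanifold k (J '' S) := by
  refine IsSliceChart.isSmoothSubmanifold ?_
  rintro _ ⟨x, hx, rfl⟩
  obtain ⟨Φ, W, hΦ, hxs, hW, hk⟩ := hS.exists_isSliceChart hx
  refine ⟨(J.symm.toHomeomorph.toOpenPartialHomeomorph.trans Φ).trans
    J.toHomeomorph.toOpenPartialHomeomorph, W.map (J.toLinearEquiv : F →ₗ[ℝ] F'),
    isSliceChart_of_mem_iff ?_ ?_ ?_, ?_, inferInstance, ?_⟩
  · refine J.contDiff.comp_contDiffOn (hΦ.contDiffOn.comp J.symm.contDiff.contDiffOn ?_)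
    intro y hy
    simpa using hy
  · refine J.contDiff.comp_contDiffOn (hΦ.contDiffOn_symm.comp J.symm.contDiff.contDiffOn ?_)
    intro y hy
    simpa using hy
  · intro y hy
    have hy' : J.symm y ∈ Φ.source := by simpa using hy
    have h1 := hΦ.apply_mem_iff hy'
    have h2 : y ∈ J '' S ↔ J.symm y ∈ S := by
      constructor
      · rintro ⟨z, hz, rfl⟩
        simpa using hz
      · intro hz
        exact ⟨_, hz, J.apply_symm_apply y⟩
    rw [h2, ← h1]
    constructor
    · intro hz
      exact ⟨_, hz, rfl⟩
    · rintro ⟨w, hw, hwe⟩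
      have : w = Φ (J.symm y) := J.injective hwe
      rwa [← this]
  · simpa using hxs
  · rw [LinearEquiv.finrank_map_eq, hk]

theorem mem_tangentSpaceAt_image_iff (J : F ≃L[ℝ] F') {S : Set F} {x v : F} :
    J v ∈ tangentSpaceAt (J '' S) (J x) ↔ v ∈ tangentSpaceAt S x := by
  constructor
  · intro h
    have := map_mem_tangentSpaceAt (X := S) (f := J.symm) J.symm.differentiableAt
      Filter.univ_mem (by rintro _ ⟨⟨y, hy, rfl⟩, -⟩; simpa using hy) h
    simpa [ContinuousLinearEquiv.fderiv] using this
  · intro h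
    have := map_mem_tangentSpaceAt (X := J '' S) (f := J) J.differentiableAt
      Filter.univ_mem (by rintro y ⟨hy, -⟩; exact ⟨y, hy, rfl⟩) h
    simpa [ContinuousLinearEquiv.fderiv] using this

end Transport

/-! ### Annihilators and cotangent lifts of slice charts. -/

section Riesz

variable {E : Type*} [NormedAddCommGroup E] [InnerProductSpace ℝ E]

variable (E) in
/-- The musical isomorphism `v ↦ ⟪v, ·⟫` of a Euclidean space with its dual. -/
def rieszEquiv [FiniteDimensional ℝ E] : E ≃L[ℝ] (E →L[ℝ] ℝ) :=
  LinearEquiv.toContinuousLinearEquiv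
    { toFun := fun v => InnerProductSpace.toDual ℝ E v
      map_add' := fun v w => map_add _ v w
      map_smul' := fun c v => by simp
      invFun := fun l => (InnerProductSpace.toDual ℝ E).symm l
      left_inv := fun v => by simp
      right_inv := fun l => by simp }

@[simp]
theorem rieszEquiv_apply [FiniteDimensional ℝ E] (v w : E) : rieszEquiv E v w = inner ℝ v w := rfl

/-- The covectors that vanish on `W`. -/
def annihilator (W : Submodule ℝ E) : Submodule ℝ (E →L[ℝ] ℝ) where
  carrier := {l | ∀ w ∈ W, l w = 0}
  add_mem' := fun ha hb w hw => by simp [ha w hw, hb w hw]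
  zero_mem' := fun w _ => rfl
  smul_mem' := fun c a ha w hw => by simp [ha w hw]

theorem rieszEquiv_mem_annihilator [FiniteDimensional ℝ E] {W : Submodule ℝ E} {v : E} :
    rieszEquiv E v ∈ annihilator W ↔ v ∈ Wᗮ := by
  rw [Submodule.mem_orthogonal']
  rfl

theorem finrank_add_finrank_annihilator [FiniteDimensional ℝ E] (W : Submodule ℝ E) :
    Module.finrank ℝ W + Module.finrank ℝ (annihilator W) = Module.finrank ℝ E := by
  rw [← W.finrank_add_finrank_orthogonal]
  congr 1
  have h : annihilator W = Wᗮ.map ((rieszEquiv E).toLinearEquiv : E →ₗ[ℝ] (E →L[ℝ] ℝ)) := by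
    ext l
    rw [Submodule.mem_map_equiv, ← rieszEquiv_mem_annihilator]
    exact iff_of_eq (congrArg (· ∈ annihilator W) ((rieszEquiv E).apply_symm_apply l).symm)
  rw [h]
  exact LinearEquiv.finrank_map_eq _ _

theorem IsSliceChart.contDiffOn_cotangentLift {S : Set E} {Φ : OpenPartialHomeomorph E E}
    {W : Submodule ℝ E} (h : IsSliceChart S Φ W) {M : E → E →L[ℝ] ℝ}
    (hM : ContDiffOn ℝ ∞ M Φ.source) :
    ContDiffOn ℝ ∞ (fun a : E × (E →L[ℝ] ℝ) =>
      (Φ a.1, (a.2 - M a.1).comp (fderiv ℝ Φ.symm (Φ a.1)))) (Φ.source ×ˢ Set.univ) := by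
  have h1 : ContDiffOn ℝ ∞ (fun a : E × (E →L[ℝ] ℝ) => a.1) (Φ.source ×ˢ Set.univ) :=
    contDiff_fst.contDiffOn
  have hfst : Set.MapsTo (fun a : E × (E →L[ℝ] ℝ) => a.1) (Φ.source ×ˢ Set.univ) Φ.source :=
    fun a ha => ha.1
  have hΦ := h.contDiffOn.comp h1 hfst
  have hD : ContDiffOn ℝ ∞ (fderiv ℝ Φ.symm) Φ.target :=
    h.contDiffOn_symm.fderiv_of_isOpen Φ.open_target (by simp)
  refine hΦ.prodMk (ContDiffOn.clm_comp ?_ ?_)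
  · exact contDiff_snd.contDiffOn.sub (hM.comp h1 hfst)
  · exact hD.comp hΦ fun a ha => Φ.map_source ha.1

theorem IsSliceChart.contDiffOn_cotangentLift_symm {S : Set E} {Φ : OpenPartialHomeomorph E E}
    {W : Submodule ℝ E} (h : IsSliceChart S Φ W) {M : E → E →L[ℝ] ℝ}
    (hM : ContDiffOn ℝ ∞ M Φ.source) :
    ContDiffOn ℝ ∞ (fun b : E × (E →L[ℝ] ℝ) =>
      (Φ.symm b.1, b.2.comp (fderiv ℝ Φ (Φ.symm b.1)) + M (Φ.symm b.1)))
      (Φ.target ×ˢ Set.univ) := by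
  have h1 : ContDiffOn ℝ ∞ (fun a : E × (E →L[ℝ] ℝ) => a.1) (Φ.target ×ˢ Set.univ) :=
    contDiff_fst.contDiffOn
  have hfst : Set.MapsTo (fun a : E × (E →L[ℝ] ℝ) => a.1) (Φ.target ×ˢ Set.univ) Φ.target :=
    fun a ha => ha.1
  have hΦ := h.contDiffOn_symm.comp h1 hfst
  have hm : Set.MapsTo (fun a : E × (E →L[ℝ] ℝ) => Φ.symm a.1) (Φ.target ×ˢ Set.univ) Φ.source :=
    fun a ha => Φ.map_target ha.1
  have hD : ContDiffOn ℝ ∞ (fderiv ℝ Φ) Φ.source :=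
    h.contDiffOn.fderiv_of_isOpen Φ.open_source (by simp)
  refine hΦ.prodMk (ContDiffOn.add (ContDiffOn.clm_comp contDiff_snd.contDiffOn ?_) ?_)
  · exact hD.comp hΦ hm
  · exact hM.comp hΦ hm

/-- The cotangent lift `(x, ξ) ↦ (Φ x, (ξ - M x) ∘ (DΦ x)⁻¹)` of a slice chart, twisted by the
1-form `M`. -/
def IsSliceChart.cotangentLift {S : Set E} {Φ : OpenPartialHomeomorph E E} {W : Submodule ℝ E}
    (h : IsSliceChart S Φ W) {M : E → E →L[ℝ] ℝ} (hM : ContDiffOn ℝ ∞ M Φ.source) :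
    OpenPartialHomeomorph (E × (E →L[ℝ] ℝ)) (E × (E →L[ℝ] ℝ)) where
  toFun a := (Φ a.1, (a.2 - M a.1).comp (fderiv ℝ Φ.symm (Φ a.1)))
  invFun b := (Φ.symm b.1, b.2.comp (fderiv ℝ Φ (Φ.symm b.1)) + M (Φ.symm b.1))
  source := Φ.source ×ˢ Set.univ
  target := Φ.target ×ˢ Set.univ
  map_source' a ha := ⟨Φ.map_source ha.1, trivial⟩
  map_target' b hb := ⟨Φ.map_target hb.1, trivial⟩
  left_inv' a ha := by
    refine Prod.ext (Φ.left_inv ha.1) ?_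
    simp only [Φ.left_inv ha.1, ContinuousLinearMap.comp_assoc, h.fderiv_symm_comp_fderiv ha.1,
      ContinuousLinearMap.comp_id, sub_add_cancel]
  right_inv' b hb := by
    refine Prod.ext (Φ.right_inv hb.1) ?_
    have h1 := h.fderiv_comp_fderiv_symm (Φ.map_target hb.1)
    rw [Φ.right_inv hb.1] at h1
    simp only [Φ.right_inv hb.1, add_sub_cancel_right, ContinuousLinearMap.comp_assoc, h1,
      ContinuousLinearMap.comp_id]
  open_source := Φ.open_source.prod isOpen_univ
  open_target := Φ.open_target.prod isOpen_univ
  continuousOn_toFun := (h.contDiffOn_cotangentLift hM).continuousOn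
  continuousOn_invFun := (h.contDiffOn_cotangentLift_symm hM).continuousOn

/-- The set of `(x, ξ)` with `x ∈ S` and `ξ = M x` on `T_x S` is straightened by the twisted
cotangent lift. -/
theorem IsSliceChart.isSliceChart_cotangentLift [FiniteDimensional ℝ E] {S : Set E} {Φ : OpenPartialHomeomorph E E}
    {W : Submodule ℝ E} (h : IsSliceChart S Φ W) {M : E → E →L[ℝ] ℝ}
    (hM : ContDiffOn ℝ ∞ M Φ.source) {X : Set (E × (E →L[ℝ] ℝ))}
    (hX : ∀ a : E × (E →L[ℝ] ℝ), a.1 ∈ Φ.source →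
      (a ∈ X ↔ a.1 ∈ S ∧ a.2 - M a.1 ∈ annihilator (tangentSpaceAt S a.1))) :
    IsSliceChart X (h.cotangentLift hM) (W.prod (annihilator W)) := by
  refine isSliceChart_of_mem_iff (h.contDiffOn_cotangentLift hM)
    (h.contDiffOn_cotangentLift_symm hM) ?_
  rintro ⟨x, ξ⟩ ⟨hx : x ∈ Φ.source, -⟩
  rw [hX _ hx, Submodule.mem_prod]
  change _ ↔ Φ x ∈ W ∧ (ξ - M x).comp (fderiv ℝ Φ.symm (Φ x)) ∈ annihilator W
  rw [h.apply_mem_iff hx]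
  refine and_congr_right fun hxS => ?_
  have h1 (v : E) : fderiv ℝ Φ.symm (Φ x) (fderiv ℝ Φ x v) = v :=
    DFunLike.congr_fun (h.fderiv_symm_comp_fderiv hx) v
  have h2 (v : E) : fderiv ℝ Φ x (fderiv ℝ Φ.symm (Φ x) v) = v :=
    DFunLike.congr_fun (h.fderiv_comp_fderiv_symm hx) v
  -- `DΦ x` maps the tangent space of `S` onto `W`, so a covector kills the former iff its transport
  -- by the inverse kills the latter.
  constructor
  · intro hξ w hw
    refine hξ _ ((h.mem_tangentSpaceAt_iff ⟨hxS, hx⟩).2 ?_)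
    change fderiv ℝ Φ x (fderiv ℝ Φ.symm (Φ x) w) ∈ W
    rwa [h2]
  · intro hξ v hv
    have := hξ _ ((h.mem_tangentSpaceAt_iff ⟨hxS, hx⟩).1 hv)
    rwa [ContinuousLinearMap.comp_apply, h1] at this

end Riesz

/-! ### Closed 1-forms, covariant derivatives and normal fields. -/

section Forms

variable {n : ℕ} {L : Set (EuclideanSpace ℝ (Fin n))}

local notation "𝔼" n => EuclideanSpace ℝ (Fin n)

theorem OneFormOn.ambient_apply (μ : OneFormOn L) {x : 𝔼 n} (hx : x ∈ L)
    (v : tangentSpaceAt L x) : μ.ambient x v = μ ⟨x, hx⟩ v := by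
  simp [OneFormOn.ambient, hx]

theorem mem_twistedConormal_iff (μ : OneFormOn L) (a : (𝔼 n) × ((𝔼 n) →L[ℝ] ℝ)) :
    a ∈ twistedConormal μ ↔
      a.1 ∈ L ∧ a.2 - μ.ambient a.1 ∈ annihilator (tangentSpaceAt L a.1) := by
  refine and_congr_right fun _ => ⟨?_, fun h => ⟨_, h, by abel⟩⟩
  rintro ⟨ξ, hξ, h⟩
  rw [h, add_sub_cancel_right]
  exact hξ

/-- A closed 1-form on `L` has symmetric derivative in tangential directions, for every smooth
1-form on an open set that restricts to it. -/
theorem OneFormOn.IsClosedForm.fderiv_comm {μ : OneFormOn L} (hdμ : μ.IsClosedForm)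
    {U : Set (𝔼 n)} (hU : IsOpen U) {η : (𝔼 n) → (𝔼 n) →L[ℝ] ℝ} (hη : ContDiffOn ℝ ∞ η U)
    (hηL : ∀ y ∈ L ∩ U, η y - μ.ambient y ∈ annihilator (tangentSpaceAt L y))
    {x : 𝔼 n} (hx : x ∈ L ∩ U) {v w : 𝔼 n} (hv : v ∈ tangentSpaceAt L x)
    (hw : w ∈ tangentSpaceAt L x) : fderiv ℝ η x v w = fderiv ℝ η x w v := by
  let I := ContinuousAlternatingMap.ofSubsingletonLIE (𝕜 := ℝ) (E := 𝔼 n) (F := ℝ) (0 : Fin 1)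
  have hI : ContDiffOn ℝ ∞ (fun y => I (η y)) U :=
    I.toContinuousLinearEquiv.contDiff.comp_contDiffOn hη
  -- Closedness only needs `η` to agree with `μ` on tangent vectors, so `η` may differ from the
  -- ambient extension by a conormal field.
  have h := hdμ U (fun y => I (η y)) hU hI (fun y hy u => by
    have := hηL y ⟨y.2, hy⟩ u u.2
    rw [sub_apply, sub_eq_zero, μ.ambient_apply y.2] at this
    exact this) x hx v hv w hw
  have hηd : DifferentiableAt ℝ η x :=
    (hη.contDiffAt (hU.mem_nhds hx.2)).differentiableAt (by simp)
  rw [extDeriv_apply ((hI.contDiffAt (hU.mem_nhds hx.2)).differentiableAt (by simp))] at h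
  have hev (u t : 𝔼 n) : fderiv ℝ (fun y => η y u) x t = fderiv ℝ η x t u := by
    rw [fderiv_clm_apply hηd (differentiableAt_const u)]
    simp
  have h2 : (fderiv ℝ (fun y => η y w) x) v - (fderiv ℝ (fun y => η y v) x) w = 0 := by
    rw [Fin.sum_univ_two] at h
    rw [sub_eq_add_neg]
    convert! h using 2
    · simp only [Fin.val_zero, pow_zero, one_smul]
      rfl
    · simp only [Fin.val_one, pow_one, neg_smul, one_smul]
      rfl
  rw [hev, hev] at h2
  exact sub_eq_zero.1 h2

theorem OneFormOn.covDeriv_comm {μ : OneFormOn L} (hμ : μ.IsSmooth) (hdμ : μ.IsClosedForm)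
    {x : 𝔼 n} (hx : x ∈ L) {v w : 𝔼 n} (hv : v ∈ tangentSpaceAt L x)
    (hw : w ∈ tangentSpaceAt L x) : μ.covDeriv x v w = μ.covDeriv x w v := by
  obtain ⟨U, M, hU, hxU, hM, hML⟩ := hμ x hx
  have hMd := (hM.contDiffAt (hU.mem_nhds hxU)).differentiableAt (by simp)
  unfold OneFormOn.covDeriv
  rw [derivAlong_eq_fderiv hx (hU.mem_nhds hxU) hMd hML hv,
    derivAlong_eq_fderiv hx (hU.mem_nhds hxU) hMd hML hw]
  refine hdμ.fderiv_comm hU hM (fun y hy => ?_) ⟨hx, hxU⟩ hv hw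
  rw [hML y hy, sub_self]
  exact Submodule.zero_mem _

theorem OneFormOn.symCovDerivMatrix_apply {p : ℕ} {μ : OneFormOn L} (hμ : μ.IsSmooth)
    (hdμ : μ.IsClosedForm) {x : 𝔼 n} (hx : x ∈ L)
    (e : OrthonormalBasis (Fin p) ℝ (tangentSpaceAt L x)) (i j : Fin p) :
    μ.symCovDerivMatrix e i j = μ.covDeriv x (e i) (e j) := by
  rw [OneFormOn.symCovDerivMatrix, Matrix.of_apply,
    OneFormOn.covDeriv_comm hμ hdμ hx (e j).2 (e i).2]
  ring

theorem OneFormOn.isSymm_symCovDerivMatrix {p : ℕ} (μ : OneFormOn L) {x : 𝔼 n}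
    (e : OrthonormalBasis (Fin p) ℝ (tangentSpaceAt L x)) : (μ.symCovDerivMatrix e).IsSymm := by
  ext i j
  simp [OneFormOn.symCovDerivMatrix, add_comm]

/-- Every normal vector at a point extends to a smooth normal field. -/
theorem IsSmoothSubmanifold.exists_isNormalField {p : ℕ} (hL : IsSmoothSubmanifold p L) {x : 𝔼 n}
    (hx : x ∈ L) {u : 𝔼 n} (hu : u ∈ (tangentSpaceAt L x)ᗮ) :
    ∃ ν : (𝔼 n) → 𝔼 n, IsNormalField L ν ∧ ν x = u := by
  obtain ⟨Φ, W, h, hxs, hW, -⟩ := hL.exists_isSliceChart hx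
  obtain ⟨f, hfs, -, hf, -, hfx⟩ := exists_contDiff_tsupport_subset (n := ⊤)
    (Φ.open_source.mem_nhds hxs)
  -- Transported to the chart, the covector of `u` is kept constant. It vanishes on `W`, so its
  -- pullback by `DΦ y` is conormal at every nearby `y ∈ L`.
  let l : (𝔼 n) →L[ℝ] ℝ := (rieszEquiv (𝔼 n) u).comp (fderiv ℝ Φ.symm (Φ x))
  let ν₀ : (𝔼 n) → 𝔼 n := fun y => (rieszEquiv (𝔼 n)).symm (l.comp (fderiv ℝ Φ y))
  have hν₀ : ContDiffOn ℝ ∞ ν₀ Φ.source :=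
    (rieszEquiv (𝔼 n)).symm.contDiff.comp_contDiffOn
      (contDiffOn_const.clm_comp (h.contDiffOn.fderiv_of_isOpen Φ.open_source (by simp)))
  have hl : ∀ w ∈ W, l w = 0 := by
    intro w hw
    have h1 : fderiv ℝ Φ.symm (Φ x) w ∈ tangentSpaceAt L x := by
      rw [h.mem_tangentSpaceAt_iff ⟨hx, hxs⟩]
      have : fderiv ℝ Φ x (fderiv ℝ Φ.symm (Φ x) w) = w :=
        DFunLike.congr_fun (h.fderiv_comp_fderiv_symm hxs) w
      rwa [this]
    exact (Submodule.mem_orthogonal' _ _).1 hu _ h1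
  have hν₀x : ν₀ x = u := by
    have : l.comp (fderiv ℝ Φ x) = rieszEquiv (𝔼 n) u := by
      rw [ContinuousLinearMap.comp_assoc, h.fderiv_symm_comp_fderiv hxs,
        ContinuousLinearMap.comp_id]
    simp only [ν₀, this, ContinuousLinearEquiv.symm_apply_apply]
  have hν₀n : ∀ y ∈ L ∩ Φ.source, ν₀ y ∈ (tangentSpaceAt L y)ᗮ := by
    intro y hy
    rw [← rieszEquiv_mem_annihilator, ContinuousLinearEquiv.apply_symm_apply]
    exact fun v hv => hl _ ((h.mem_tangentSpaceAt_iff hy).1 hv)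
  -- The cutoff `f` is supported in the chart domain, so the product is smooth everywhere although
  -- `ν₀` is controlled only there.
  have hsmooth : ContDiff ℝ ∞ fun y => f y • ν₀ y := by
    rw [contDiff_iff_contDiffAt]
    intro y
    by_cases hy : y ∈ tsupport f
    · exact hf.contDiffAt.smul (hν₀.contDiffAt (Φ.open_source.mem_nhds (hfs hy)))
    · refine (contDiffAt_const (c := (0 : 𝔼 n))).congr_of_eventuallyEq ?_
      filter_upwards [notMem_tsupport_iff_eventuallyEq.1 hy] with z hz
      simp [hz]
  refine ⟨fun y => f y • ν₀ y, ⟨fun y _ => ⟨Set.univ, _, isOpen_univ, trivial,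
    hsmooth.contDiffOn, fun _ _ => rfl⟩, fun y hy => ?_⟩, by simp [hfx, hν₀x]⟩
  by_cases hys : y ∈ Φ.source
  · exact Submodule.smul_mem _ _ (hν₀n y ⟨hy, hys⟩)
  · have : f y = 0 := image_eq_zero_of_notMem_tsupport fun hy' => hys (hfs hy')
    simp [this]

/-! ### The twisted conormal bundle as a submanifold of `T^*ℝⁿ` -/

theorem isSmoothSubmanifold_twistedConormal {p : ℕ} (hL : IsSmoothSubmanifold p L)
    {μ : OneFormOn L} (hμ : μ.IsSmooth) : IsSmoothSubmanifold n (twistedConormal μ) := by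
  refine IsSliceChart.isSmoothSubmanifold fun a ha => ?_
  obtain ⟨Φ, W, h, hxs, -, hk⟩ := hL.exists_isSliceChart ha.1
  obtain ⟨U, M, hU, hxU, hM, hML⟩ := hμ a.1 ha.1
  -- The chart is shrunk to the set where the local extension `M` of `μ` is smooth.
  have hM' : ContDiffOn ℝ ∞ M (Φ.restrOpen U hU).source := hM.mono Set.inter_subset_right
  refine ⟨_, _, (h.restrOpen hU).isSliceChart_cotangentLift hM' fun b hb => ?_,
    ⟨⟨hxs, hxU⟩, trivial⟩, inferInstance, ?_⟩
  · rw [mem_twistedConormal_iff]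
    refine and_congr_right fun hbL => ?_
    rw [hML b.1 ⟨hbL, hb.2⟩]
  · rw [Submodule.finrank_prod_eq, finrank_add_finrank_annihilator, finrank_euclideanSpace_fin]

/-- The derivative `v ↦ ∇_v (ν + μ)` of the section `ν + μ` of `X_μ`. -/
def OneFormOn.twistDeriv (μ : OneFormOn L) (ν : (𝔼 n) → 𝔼 n) (x : 𝔼 n) :
    (𝔼 n) →L[ℝ] ((𝔼 n) →L[ℝ] ℝ) :=
  (rieszEquiv (𝔼 n) : (𝔼 n) →L[ℝ] ((𝔼 n) →L[ℝ] ℝ)).comp (fderivWithin ℝ ν L x) +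
    fderivWithin ℝ μ.ambient L x

theorem OneFormOn.twistDeriv_apply (μ : OneFormOn L) (ν : (𝔼 n) → 𝔼 n) (x v : 𝔼 n) :
    μ.twistDeriv ν x v =
      rieszEquiv (𝔼 n) (derivAlong L ν x v) + derivAlong L μ.ambient x v := rfl

/-- The tangent space of `X_μ` at `(x, ν_x + μ_x)` consists of the vectors
`(v, ∇_v (ν + μ) + ζ)` with `v` tangent to `L` and `ζ` conormal. -/
theorem mem_tangentSpaceAt_twistedConormal_iff {p : ℕ} (hL : IsSmoothSubmanifold p L)
    {μ : OneFormOn L} (hμ : μ.IsSmooth) {ν : (𝔼 n) → 𝔼 n} (hν : IsNormalField L ν)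
    {x : 𝔼 n} (hx : x ∈ L) (b : (𝔼 n) × ((𝔼 n) →L[ℝ] ℝ)) :
    b ∈ tangentSpaceAt (twistedConormal μ) (x, rieszEquiv (𝔼 n) (ν x) + μ.ambient x) ↔
      b.1 ∈ tangentSpaceAt L x ∧
      b.2 - μ.twistDeriv ν x b.1 ∈ annihilator (tangentSpaceAt L x) := by
  let a : (𝔼 n) × ((𝔼 n) →L[ℝ] ℝ) := (x, rieszEquiv (𝔼 n) (ν x) + μ.ambient x)
  let G := μ.twistDeriv ν x
  -- The shear `(v, ζ) ↦ (v, ζ + G v)`. The claimed tangent space is its image `P` of a product of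
  -- dimension `n`, so one inclusion will suffice.
  let e : ((𝔼 n) × ((𝔼 n) →L[ℝ] ℝ)) ≃ₗ[ℝ] ((𝔼 n) × ((𝔼 n) →L[ℝ] ℝ)) :=
    (LinearEquiv.refl ℝ _).skewProd (LinearEquiv.refl ℝ _) (G : (𝔼 n) →ₗ[ℝ] ((𝔼 n) →L[ℝ] ℝ))
  let P := ((tangentSpaceAt L x).prod (annihilator (tangentSpaceAt L x))).map
    (e : ((𝔼 n) × ((𝔼 n) →L[ℝ] ℝ)) →ₗ[ℝ] ((𝔼 n) × ((𝔼 n) →L[ℝ] ℝ)))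
  have haX : a ∈ twistedConormal μ := by
    refine (mem_twistedConormal_iff μ a).2 ⟨hx, ?_⟩
    simp only [a, add_sub_cancel_right]
    exact rieszEquiv_mem_annihilator.2 (hν.2 x hx)
  obtain ⟨U, M, hU, hxU, hM, hML⟩ := hμ x hx
  obtain ⟨U', N, hU', hxU', hN, hNL⟩ := hν.1 x hx
  have hMd := (hM.contDiffAt (hU.mem_nhds hxU)).differentiableAt (by simp)
  have hNd := (hN.contDiffAt (hU'.mem_nhds hxU')).differentiableAt (by simp)
  have hle : P ≤ tangentSpaceAt (twistedConormal μ) a := by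
    rintro _ ⟨⟨v, ζ⟩, ⟨hv : v ∈ tangentSpaceAt L x, hζ : ζ ∈ annihilator _⟩, rfl⟩
    -- Velocities of the section `y ↦ (y, ν_y + μ_y)`.
    have h1 : ((v, G v) : (𝔼 n) × ((𝔼 n) →L[ℝ] ℝ)) ∈ tangentSpaceAt (twistedConormal μ) a := by
      let g : (𝔼 n) → (𝔼 n) × ((𝔼 n) →L[ℝ] ℝ) := fun y => (y, rieszEquiv (𝔼 n) (N y) + M y)
      have hg : HasFDerivAt g ((ContinuousLinearMap.id ℝ _).prod
          ((rieszEquiv (𝔼 n) : (𝔼 n) →L[ℝ] ((𝔼 n) →L[ℝ] ℝ)).comp (fderiv ℝ N x) +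
            fderiv ℝ M x)) x :=
        (hasFDerivAt_id x).prodMk
          (((rieszEquiv (𝔼 n)).hasFDerivAt.comp x hNd.hasFDerivAt).add hMd.hasFDerivAt)
      have hmem := map_mem_tangentSpaceAt (X := twistedConormal μ) hg.differentiableAt
        (Filter.inter_mem (hU.mem_nhds hxU) (hU'.mem_nhds hxU'))
        (fun y hy => by
          refine (mem_twistedConormal_iff μ _).2 ⟨hy.1, ?_⟩
          simp only [g, ← hML y ⟨hy.1, hy.2.1⟩, ← hNL y ⟨hy.1, hy.2.2⟩, add_sub_cancel_right]
          exact rieszEquiv_mem_annihilator.2 (hν.2 y hy.1)) hv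
      rw [hg.fderiv] at hmem
      have hga : g x = a := by
        simp only [g, a, hML x ⟨hx, hxU⟩, hNL x ⟨hx, hxU'⟩]
      rw [hga] at hmem
      convert! hmem using 1
      refine Prod.ext rfl ?_
      have h2 := derivAlong_eq_fderiv hx (hU.mem_nhds hxU) hMd hML hv
      have h3 := derivAlong_eq_fderiv hx (hU'.mem_nhds hxU') hNd hNL hv
      change μ.twistDeriv ν x v = rieszEquiv (𝔼 n) (fderiv ℝ N x v) + fderiv ℝ M x v
      rw [OneFormOn.twistDeriv_apply, h2, h3]
    -- Velocities inside the fibre, an affine translate of the conormal space.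
    have h2 : ((0, ζ) : (𝔼 n) × ((𝔼 n) →L[ℝ] ℝ)) ∈ tangentSpaceAt (twistedConormal μ) a := by
      let g : ((𝔼 n) →L[ℝ] ℝ) → (𝔼 n) × ((𝔼 n) →L[ℝ] ℝ) := fun ξ => (x, a.2 + ξ)
      have hg : HasFDerivAt g (ContinuousLinearMap.inr ℝ _ _) 0 :=
        (hasFDerivAt_const x 0).prodMk ((hasFDerivAt_id 0).const_add a.2)
      have hζ' : ζ ∈ tangentSpaceAt
          (annihilator (tangentSpaceAt L x) : Set ((𝔼 n) →L[ℝ] ℝ)) 0 := by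
        refine Submodule.subset_span ?_
        simpa using mem_tangentConeAt_of_segment_subset
          ((annihilator (tangentSpaceAt L x)).convex.segment_subset (Submodule.zero_mem _) hζ)
      have hmem := map_mem_tangentSpaceAt (X := twistedConormal μ) hg.differentiableAt
        Filter.univ_mem (fun ξ hξ => by
          refine (mem_twistedConormal_iff μ _).2 ⟨hx, ?_⟩
          have := (annihilator (tangentSpaceAt L x)).add_mem
            ((mem_twistedConormal_iff μ a).1 haX).2 hξ.1
          simpa [g, add_sub_right_comm] using this) hζ'
      rw [hg.fderiv] at hmem
      simpa [g, a] using hmem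
    have : e (v, ζ) = (v, G v) + (0, ζ) := by
      simp [e, add_comm]
    change e (v, ζ) ∈ _
    rw [this]
    exact Submodule.add_mem _ h1 h2
  have hPeq : P = tangentSpaceAt (twistedConormal μ) a := by
    refine Submodule.eq_of_le_of_finrank_eq hle ?_
    rw [(isSmoothSubmanifold_twistedConormal hL hμ).finrank_tangentSpaceAt haX,
      LinearEquiv.finrank_map_eq, Submodule.finrank_prod_eq, finrank_add_finrank_annihilator,
      finrank_euclideanSpace_fin]
  change b ∈ tangentSpaceAt (twistedConormal μ) a ↔ _
  rw [← hPeq, Submodule.mem_map_equiv, Submodule.mem_prod]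
  rfl

/-- The point `(x, ξ)` of `X_μ` is the value at `x` of `ν + μ` for some smooth normal field `ν`. -/
theorem exists_isNormalField_of_mem_twistedConormal {p : ℕ} (hL : IsSmoothSubmanifold p L)
    {μ : OneFormOn L} {a : (𝔼 n) × ((𝔼 n) →L[ℝ] ℝ)} (ha : a ∈ twistedConormal μ) :
    ∃ ν : (𝔼 n) → 𝔼 n, IsNormalField L ν ∧
      a = (a.1, rieszEquiv (𝔼 n) (ν a.1) + μ.ambient a.1) := by
  rw [mem_twistedConormal_iff] at ha
  obtain ⟨ν, hν, hνa⟩ := hL.exists_isNormalField ha.1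
    (u := (rieszEquiv (𝔼 n)).symm (a.2 - μ.ambient a.1)) (by
      rw [← rieszEquiv_mem_annihilator, ContinuousLinearEquiv.apply_symm_apply]
      exact ha.2)
  exact ⟨ν, hν, by rw [hνa]; simp⟩

/-- The canonical symplectic form vanishes on `X_μ`. -/
theorem symplectic_twistedConormal {p : ℕ} (hL : IsSmoothSubmanifold p L)
    {μ : OneFormOn L} (hμ : μ.IsSmooth) (hdμ : μ.IsClosedForm)
    {a : (𝔼 n) × ((𝔼 n) →L[ℝ] ℝ)} (ha : a ∈ twistedConormal μ)
    {b c : (𝔼 n) × ((𝔼 n) →L[ℝ] ℝ)} (hb : b ∈ tangentSpaceAt (twistedConormal μ) a)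
    (hc : c ∈ tangentSpaceAt (twistedConormal μ) a) : b.2 c.1 = c.2 b.1 := by
  obtain ⟨ν, hν, hνa⟩ := exists_isNormalField_of_mem_twistedConormal hL ha
  have hx := ha.1
  rw [hνa, mem_tangentSpaceAt_twistedConormal_iff hL hμ hν hx] at hb hc
  set x := a.1
  obtain ⟨U, M, hU, hxU, hM, hML⟩ := hμ x hx
  obtain ⟨U', N, hU', hxU', hN, hNL⟩ := hν.1 x hx
  have hη : ContDiffOn ℝ ∞ (fun y => rieszEquiv (𝔼 n) (N y) + M y) (U ∩ U') :=
    ((rieszEquiv (𝔼 n)).contDiff.comp_contDiffOn (hN.mono Set.inter_subset_right)).add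
      (hM.mono Set.inter_subset_left)
  have hMd := (hM.contDiffAt (hU.mem_nhds hxU)).differentiableAt (by simp)
  have hNd := (hN.contDiffAt (hU'.mem_nhds hxU')).differentiableAt (by simp)
  have hD : HasFDerivAt (fun y => rieszEquiv (𝔼 n) (N y) + M y)
      ((rieszEquiv (𝔼 n) : (𝔼 n) →L[ℝ] ((𝔼 n) →L[ℝ] ℝ)).comp (fderiv ℝ N x) + fderiv ℝ M x) x :=
    ((rieszEquiv (𝔼 n)).hasFDerivAt.comp x hNd.hasFDerivAt).add hMd.hasFDerivAt
  -- The normal part vanishes on tangent vectors, so `ν + μ` still restricts to `μ`. This one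
  -- symmetry covers both `A^ν` and `B`.
  have hsymm := hdμ.fderiv_comm (hU.inter hU') hη (fun y hy => by
    rw [← hML y ⟨hy.1, hy.2.1⟩, ← hNL y ⟨hy.1, hy.2.2⟩, add_sub_cancel_right]
    exact rieszEquiv_mem_annihilator.2 (hν.2 y hy.1)) ⟨hx, hxU, hxU'⟩ hb.1 hc.1
  -- The conormal correction in `b.2` disappears on the tangent vector `c.1`.
  have key {b c : (𝔼 n) × ((𝔼 n) →L[ℝ] ℝ)} (hb : b.1 ∈ tangentSpaceAt L x ∧
      b.2 - μ.twistDeriv ν x b.1 ∈ annihilator (tangentSpaceAt L x)) (hc : c.1 ∈ tangentSpaceAt L x) :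
      b.2 c.1 = fderiv ℝ (fun y => rieszEquiv (𝔼 n) (N y) + M y) x b.1 c.1 := by
    rw [OneFormOn.twistDeriv_apply, derivAlong_eq_fderiv hx (hU.mem_nhds hxU) hMd hML hb.1,
      derivAlong_eq_fderiv hx (hU'.mem_nhds hxU') hNd hNL hb.1] at hb
    rw [hD.fderiv]
    exact sub_eq_zero.1 (hb.2 c.1 hc)
  rw [key hb hc.1, key hc hb.1, hsymm]

end Forms

/-! ### Determinants `det (I + i (t A + B))` and the functions `σ_k` -/

section Algebra

open Matrix

variable {p : ℕ}

theorem eval_det_one_add_X_smul (C : Matrix (Fin p) (Fin p) ℂ) (z : ℂ) :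
    (det (1 + (Polynomial.X : Polynomial ℂ) • C.map Polynomial.C)).eval z = det (1 + z • C) := by
  rw [← Polynomial.coe_evalRingHom, RingHom.map_det]
  congr 1
  ext i j
  simp [Matrix.one_apply, apply_ite (Polynomial.eval z), mul_comm z]

theorem matrixSigma_zero (C : Matrix (Fin p) (Fin p) ℂ) : matrixSigma 0 C = 1 := by
  rw [matrixSigma, Polynomial.coeff_zero_eq_eval_zero, eval_det_one_add_X_smul]
  simp

theorem matrixSigma_eq_zero_of_lt {k : ℕ} (hk : p < k) (C : Matrix (Fin p) (Fin p) ℂ) :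
    matrixSigma k C = 0 := by
  refine Polynomial.coeff_eq_zero_of_natDegree_lt (lt_of_le_of_lt ?_ hk)
  have := Polynomial.natDegree_det_X_add_C_le C 1
  rwa [Fintype.card_fin, Matrix.map_one _ Polynomial.C_0 Polynomial.C_1, add_comm] at this

theorem conj_matrixSigma (k : ℕ) (C : Matrix (Fin p) (Fin p) ℂ) :
    (starRingEnd ℂ) (matrixSigma k C) = matrixSigma k (C.map (starRingEnd ℂ)) := by
  rw [matrixSigma, matrixSigma, ← Polynomial.coeff_map, ← Polynomial.coe_mapRingHom,
    RingHom.map_det]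
  congr 2
  ext1 i j
  simp [Matrix.one_apply, apply_ite (Polynomial.map (starRingEnd ℂ))]

theorem conj_onePlus (c : ℂ) (B : Matrix (Fin p) (Fin p) ℝ) :
    (onePlus c B).map (starRingEnd ℂ) = onePlus ((starRingEnd ℂ) c) B := by
  ext i j
  simp [onePlus, Matrix.one_apply, apply_ite (starRingEnd ℂ)]

/-- For symmetric real `B`, `(I + iB)(I - iB) = I + BᵀB`, which is positive definite. -/
theorem det_onePlus_I_ne_zero {B : Matrix (Fin p) (Fin p) ℝ} (hB : B.IsSymm) :
    (onePlus Complex.I B).det ≠ 0 := by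
  have h1 : onePlus Complex.I B * onePlus (-Complex.I) B =
      (1 + Bᴴ * B).map Complex.ofRealHom := by
    have h2 : (1 + Bᴴ * B).map Complex.ofRealHom =
        1 + B.map Complex.ofReal * B.map Complex.ofReal := by
      rw [Matrix.conjTranspose_eq_transpose_of_trivial, hB.eq]
      rw [← RingHom.mapMatrix_apply, map_add, map_one, map_mul]
      rfl
    rw [h2, onePlus, onePlus, mul_add, add_mul, add_mul, smul_mul_smul_comm]
    simp
  have h3 : ((1 + Bᴴ * B).map Complex.ofRealHom).det ≠ 0 := by
    rw [← RingHom.mapMatrix_apply, ← RingHom.map_det]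
    have := (Matrix.PosDef.one.add_posSemidef (Matrix.posSemidef_conjTranspose_mul_self B)).det_pos
    simpa using this.ne'
  rw [← h1, det_mul] at h3
  exact left_ne_zero_of_mul h3

theorem conj_onePlus_I_inv {B : Matrix (Fin p) (Fin p) ℝ} (hB : B.IsSymm) :
    ((onePlus Complex.I B)⁻¹).map (starRingEnd ℂ) = (onePlus (-Complex.I) B)⁻¹ := by
  symm
  refine Matrix.inv_eq_left_inv ?_
  rw [← Complex.conj_I, ← conj_onePlus, ← Matrix.map_mul,
    Matrix.nonsing_inv_mul _ (det_onePlus_I_ne_zero hB).isUnit,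
    Matrix.map_one _ (map_zero _) (map_one _)]

theorem conj_matrixSigma_mul_inv (k : ℕ) (A : Matrix (Fin p) (Fin p) ℝ)
    {B : Matrix (Fin p) (Fin p) ℝ} (hB : B.IsSymm) :
    (starRingEnd ℂ) (matrixSigma k (A.map Complex.ofReal * (onePlus Complex.I B)⁻¹)) =
      matrixSigma k (A.map Complex.ofReal * (onePlus (-Complex.I) B)⁻¹) := by
  rw [conj_matrixSigma, Matrix.map_mul, conj_onePlus_I_inv hB]
  congr 2
  ext i j
  simp

/-- Factor `I + i(tA + B) = (I + itA(I + iB)⁻¹)(I + iB)`. The variable of the `σ_j` polynomial is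
thus evaluated at `it`. -/
theorem det_onePlus_I_add {A B : Matrix (Fin p) (Fin p) ℝ} (hB : B.IsSymm) (t : ℝ) :
    (onePlus Complex.I (t • A + B)).det =
      (onePlus Complex.I B).det *
        (det (1 + (Polynomial.X : Polynomial ℂ) •
          (A.map Complex.ofReal * (onePlus Complex.I B)⁻¹).map Polynomial.C)).eval
          (t * Complex.I) := by
  rw [eval_det_one_add_X_smul, mul_comm, ← det_mul, add_mul, one_mul, smul_mul_assoc,
    Matrix.nonsing_inv_mul_cancel_right _ _ (det_onePlus_I_ne_zero hB).isUnit]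
  congr 1
  ext i j
  simp [onePlus]
  ring

/-- A polynomial takes real values on the imaginary axis iff its twisted coefficients are real. -/
theorem forall_im_eval_mul_I_eq_zero_iff (P : Polynomial ℂ) (c : ℂ) :
    (∀ t : ℝ, (c * P.eval (t * Complex.I)).im = 0) ↔
      ∀ k, (c * (Complex.I ^ k * P.coeff k)).im = 0 := by
  constructor
  · intro h k
    -- `Q(X) = c P(iX)` is real on the real axis, so it agrees with its conjugate polynomial at
    -- infinitely many points and has real coefficients.
    let Q : Polynomial ℂ :=
      Polynomial.C c * P.comp (Polynomial.C Complex.I * Polynomial.X)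
    have hQ (k : ℕ) : Q.coeff k = c * (Complex.I ^ k * P.coeff k) := by
      rw [Polynomial.coeff_C_mul, Polynomial.comp_C_mul_X_coeff, mul_comm (P.coeff k)]
    have hz : Q - Q.map (starRingEnd ℂ) = 0 := by
      refine Polynomial.eq_zero_of_infinite_isRoot _
        ((Set.infinite_range_of_injective Complex.ofReal_injective).mono ?_)
      rintro _ ⟨t, rfl⟩
      have h1 : (Q.map (starRingEnd ℂ)).eval (t : ℂ) = (starRingEnd ℂ) (Q.eval (t : ℂ)) := by
        rw [Polynomial.eval_map, ← Polynomial.eval₂_at_apply, Complex.conj_ofReal]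
      have h2 : (Q.eval (t : ℂ)).im = 0 := by
        rw [Polynomial.eval_mul, Polynomial.eval_C, Polynomial.eval_comp, Polynomial.eval_mul,
          Polynomial.eval_C, Polynomial.eval_X, mul_comm Complex.I]
        exact h t
      rw [Set.mem_ofPred_eq, Polynomial.IsRoot.def, Polynomial.eval_sub, h1, sub_eq_zero]
      exact (Complex.conj_eq_iff_im.2 h2).symm
    have h3 := congrArg (fun R => Polynomial.coeff R k) hz
    simp only [Polynomial.coeff_sub, Polynomial.coeff_map, Polynomial.coeff_zero, sub_eq_zero,
      hQ] at h3
    exact Complex.conj_eq_iff_im.1 h3.symm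
  · intro h t
    rw [Polynomial.eval_eq_sum_range, Finset.mul_sum, Complex.im_sum]
    refine Finset.sum_eq_zero fun k _ => ?_
    have : c * (P.coeff k * (t * Complex.I) ^ k) =
        ((t ^ k : ℝ) : ℂ) * (c * (Complex.I ^ k * P.coeff k)) := by
      push_cast
      ring
    rw [this, Complex.im_ofReal_mul, h k, mul_zero]

/-- The sign `(-1)^k` arises from conjugating `i^k`. -/
theorem im_I_pow_mul_eq_zero_iff (k : ℕ) (z : ℂ) :
    (Complex.I ^ k * z).im = 0 ↔ z = (-1) ^ k * (starRingEnd ℂ) z := by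
  rw [← Complex.conj_eq_iff_im, map_mul, map_pow, Complex.conj_I, neg_pow, mul_comm ((-1) ^ k),
    mul_assoc, mul_right_inj' (pow_ne_zero k Complex.I_ne_zero), eq_comm]

theorem forall_im_det_onePlus_eq_zero_iff {A B : Matrix (Fin p) (Fin p) ℝ} (hB : B.IsSymm) {c : ℂ}
    (hc : c ≠ 0) :
    (∀ t : ℝ, (c * (onePlus Complex.I (t • A + B)).det).im = 0) ↔
      (c * (onePlus Complex.I B).det).im = 0 ∧ ∀ j ∈ Finset.Icc 1 p,
        matrixSigma j (A.map Complex.ofReal * (onePlus Complex.I B)⁻¹) =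
          (-1) ^ j * matrixSigma j (A.map Complex.ofReal * (onePlus (-Complex.I) B)⁻¹) := by
  set d := c * (onePlus Complex.I B).det with hd
  have hd0 : d ≠ 0 := mul_ne_zero hc (det_onePlus_I_ne_zero hB)
  simp_rw [det_onePlus_I_add hB, ← mul_assoc, ← hd, forall_im_eval_mul_I_eq_zero_iff]
  change (∀ k, (d * (Complex.I ^ k *
    matrixSigma k (A.map Complex.ofReal * (onePlus Complex.I B)⁻¹))).im = 0) ↔ _
  -- Once the `k = 0` coefficient shows `d` to be real, this nonzero real factor cancels from all
  -- the others.
  have key (hdi : d.im = 0) (k : ℕ) : (d * (Complex.I ^ k *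
      matrixSigma k (A.map Complex.ofReal * (onePlus Complex.I B)⁻¹))).im = 0 ↔
      matrixSigma k (A.map Complex.ofReal * (onePlus Complex.I B)⁻¹) =
        (-1) ^ k * matrixSigma k (A.map Complex.ofReal * (onePlus (-Complex.I) B)⁻¹) := by
    have hdr : d = (d.re : ℂ) := Complex.ext rfl hdi
    have hdr0 : d.re ≠ 0 := fun h => hd0 (by rw [hdr, h, Complex.ofReal_zero])
    rw [hdr, Complex.im_ofReal_mul, mul_eq_zero, or_iff_right hdr0, im_I_pow_mul_eq_zero_iff,
      conj_matrixSigma_mul_inv k A hB]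
  constructor
  · intro h
    have hdi : d.im = 0 := by simpa [matrixSigma_zero] using h 0
    exact ⟨hdi, fun j _ => (key hdi j).1 (h j)⟩
  · rintro ⟨hdi, h⟩ k
    rcases Nat.eq_zero_or_pos k with rfl | hk
    · simpa [matrixSigma_zero] using hdi
    · rcases le_or_gt k p with hkp | hkp
      · exact (key hdi k).2 (h k (Finset.mem_Icc.2 ⟨hk, hkp⟩))
      · simp [matrixSigma_eq_zero_of_lt hkp]

end Algebra

/-! ### Tangent frames of `X_μ` in `ℂⁿ` -/

section Complex

open Matrix

variable {n : ℕ}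

theorem covector_apply_eq_sum (l : EuclideanSpace ℝ (Fin n) →L[ℝ] ℝ)
    (u : EuclideanSpace ℝ (Fin n)) : l u = ∑ j, l (EuclideanSpace.single j 1) * u j := by
  conv_lhs => rw [← (EuclideanSpace.basisFun (Fin n) ℝ).sum_repr u]
  simp [mul_comm]

/-- `cotangentToComplex` as a continuous linear equivalence. -/
def cotangentToComplexEquiv :
    (EuclideanSpace ℝ (Fin n) × (EuclideanSpace ℝ (Fin n) →L[ℝ] ℝ)) ≃L[ℝ]
      EuclideanSpace ℂ (Fin n) :=
  LinearEquiv.toContinuousLinearEquiv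
    { toFun := cotangentToComplex
      map_add' := fun a b => by
        ext j
        simp [cotangentToComplex]
        ring
      map_smul' := fun c a => by
        ext j
        simp [cotangentToComplex]
        ring
      invFun := fun z => (WithLp.toLp 2 fun j => (z j).re,
        rieszEquiv _ (WithLp.toLp 2 fun j => (z j).im))
      left_inv := fun a => by
        refine Prod.ext ?_ ?_
        · ext j
          simp [cotangentToComplex]
        · ext u
          rw [covector_apply_eq_sum a.2, rieszEquiv_apply, PiLp.inner_apply]
          refine Finset.sum_congr rfl fun j _ => ?_
          simp [cotangentToComplex, mul_comm]
      right_inv := fun z => by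
        ext j
        simp [cotangentToComplex, EuclideanSpace.inner_single_right, mul_comm Complex.I] }

theorem cotangentToComplexEquiv_apply
    (a : EuclideanSpace ℝ (Fin n) × (EuclideanSpace ℝ (Fin n) →L[ℝ] ℝ)) :
    cotangentToComplexEquiv a = cotangentToComplex a := rfl

theorem kahlerForm_cotangentToComplex
    (a b : EuclideanSpace ℝ (Fin n) × (EuclideanSpace ℝ (Fin n) →L[ℝ] ℝ)) :
    kahlerForm (cotangentToComplex a) (cotangentToComplex b) = b.2 a.1 - a.2 b.1 := by
  rw [covector_apply_eq_sum b.2, covector_apply_eq_sum a.2, ← Finset.sum_sub_distrib]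
  refine Finset.sum_congr rfl fun j _ => ?_
  simp [cotangentToComplex]
  ring

/-- This computes `Ω` in an adapted frame of `ℝⁿ` in place of the coordinate frame. -/
theorem sum_cotangentToComplex_mul
    (a : EuclideanSpace ℝ (Fin n) × (EuclideanSpace ℝ (Fin n) →L[ℝ] ℝ))
    (u : EuclideanSpace ℝ (Fin n)) :
    ∑ j, cotangentToComplex a j * (u j : ℂ) =
      ((inner ℝ a.1 u : ℝ) : ℂ) + Complex.I * ((a.2 u : ℝ) : ℂ) := by
  rw [covector_apply_eq_sum a.2, PiLp.inner_apply]
  push_cast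
  rw [Finset.mul_sum, ← Finset.sum_add_distrib]
  refine Finset.sum_congr rfl fun j _ => ?_
  simp [cotangentToComplex]
  ring

variable {L : Set (EuclideanSpace ℝ (Fin n))}

theorem isLagrangian_twistedConormalComplex {p : ℕ} (hL : IsSmoothSubmanifold p L)
    {μ : OneFormOn L} (hμ : μ.IsSmooth) (hdμ : μ.IsClosedForm) :
    IsLagrangian (twistedConormalComplex μ) := by
  refine ⟨(isSmoothSubmanifold_twistedConormal hL hμ).image cotangentToComplexEquiv, ?_⟩
  rintro _ ⟨a, ha, rfl⟩ u hu v hv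
  obtain ⟨b, rfl⟩ := cotangentToComplexEquiv.surjective u
  obtain ⟨c, rfl⟩ := cotangentToComplexEquiv.surjective v
  have hb := (mem_tangentSpaceAt_image_iff cotangentToComplexEquiv).1 hu
  have hc := (mem_tangentSpaceAt_image_iff cotangentToComplexEquiv).1 hv
  rw [cotangentToComplexEquiv_apply, cotangentToComplexEquiv_apply, kahlerForm_cotangentToComplex,
    symplectic_twistedConormal hL hμ hdμ ha hc hb, sub_self]

/-- The tangent frame of `X_μ` along the section `ν + μ`, adapted to orthonormal frames of the
tangent and the normal space of `L`. -/
def twistedFrame {p q : ℕ} (μ : OneFormOn L)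
    (ν : EuclideanSpace ℝ (Fin n) → EuclideanSpace ℝ (Fin n)) {x : EuclideanSpace ℝ (Fin n)}
    (e : OrthonormalBasis (Fin p) ℝ (tangentSpaceAt L x))
    (f : OrthonormalBasis (Fin q) ℝ (tangentSpaceAt L x)ᗮ) :
    Fin p ⊕ Fin q → EuclideanSpace ℝ (Fin n) × (EuclideanSpace ℝ (Fin n) →L[ℝ] ℝ) :=
  Sum.elim (fun i => ((e i : EuclideanSpace ℝ (Fin n)), μ.twistDeriv ν x (e i)))
    (fun k => (0, rieszEquiv _ (f k : EuclideanSpace ℝ (Fin n))))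

theorem twistedFrame_mem {p q : ℕ} (hL : IsSmoothSubmanifold p L) {μ : OneFormOn L}
    (hμ : μ.IsSmooth) {ν : EuclideanSpace ℝ (Fin n) → EuclideanSpace ℝ (Fin n)}
    (hν : IsNormalField L ν) {x : EuclideanSpace ℝ (Fin n)} (hx : x ∈ L)
    (e : OrthonormalBasis (Fin p) ℝ (tangentSpaceAt L x))
    (f : OrthonormalBasis (Fin q) ℝ (tangentSpaceAt L x)ᗮ) (k : Fin p ⊕ Fin q) :
    twistedFrame μ ν e f k ∈
      tangentSpaceAt (twistedConormal μ) (x, rieszEquiv _ (ν x) + μ.ambient x) := by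
  rw [mem_tangentSpaceAt_twistedConormal_iff hL hμ hν hx]
  rcases k with i | k
  · exact ⟨(e i).2, by simp [twistedFrame]⟩
  · refine ⟨Submodule.zero_mem _, ?_⟩
    simpa [twistedFrame] using rieszEquiv_mem_annihilator.2 (f k).2

/-- Spanning over `ℝ` allows the phase condition to be tested on this single frame. -/
theorem exists_eq_sum_twistedFrame {p q : ℕ} (hL : IsSmoothSubmanifold p L) {μ : OneFormOn L}
    (hμ : μ.IsSmooth) {ν : EuclideanSpace ℝ (Fin n) → EuclideanSpace ℝ (Fin n)}
    (hν : IsNormalField L ν) {x : EuclideanSpace ℝ (Fin n)} (hx : x ∈ L)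
    (e : OrthonormalBasis (Fin p) ℝ (tangentSpaceAt L x))
    (f : OrthonormalBasis (Fin q) ℝ (tangentSpaceAt L x)ᗮ)
    {b : EuclideanSpace ℝ (Fin n) × (EuclideanSpace ℝ (Fin n) →L[ℝ] ℝ)}
    (hb : b ∈ tangentSpaceAt (twistedConormal μ) (x, rieszEquiv _ (ν x) + μ.ambient x)) :
    ∃ r : Fin p ⊕ Fin q → ℝ, b = ∑ k, r k • twistedFrame μ ν e f k := by
  obtain ⟨h1, h2⟩ := (mem_tangentSpaceAt_twistedConormal_iff hL hμ hν hx b).1 hb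
  obtain ⟨z, hz⟩ := (rieszEquiv (EuclideanSpace ℝ (Fin n))).surjective
    (b.2 - μ.twistDeriv ν x b.1)
  rw [← hz, rieszEquiv_mem_annihilator] at h2
  have he : ∑ i, e.repr ⟨b.1, h1⟩ i • (e i : EuclideanSpace ℝ (Fin n)) = b.1 := by
    simpa using congrArg (Subtype.val) (e.sum_repr ⟨b.1, h1⟩)
  have hf : ∑ k, f.repr ⟨z, h2⟩ k • (f k : EuclideanSpace ℝ (Fin n)) = z := by
    simpa using congrArg (Subtype.val) (f.sum_repr ⟨z, h2⟩)
  refine ⟨Sum.elim (fun i => e.repr ⟨b.1, h1⟩ i) (fun k => f.repr ⟨z, h2⟩ k), ?_⟩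
  rw [Fintype.sum_sum_type]
  refine Prod.ext ?_ ?_
  · simp only [twistedFrame, Sum.elim_inl, Sum.elim_inr, Prod.fst_add, Prod.fst_sum,
      Prod.smul_fst, smul_zero, Finset.sum_const_zero, add_zero]
    exact he.symm
  · simp only [twistedFrame, Sum.elim_inl, Sum.elim_inr, Prod.snd_add, Prod.snd_sum,
      Prod.smul_snd]
    simp only [← map_smul, ← map_sum]
    rw [he, hf, hz]
    abel

/-- The matrix of a frame of `ℝⁿ` with complex entries. -/
def complexFrameMatrix {ι : Type*} (u : ι → EuclideanSpace ℝ (Fin n)) : Matrix ι (Fin n) ℂ :=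
  of fun k j => ((u k j : ℝ) : ℂ)

theorem of_cotangentToComplex_mul_transpose {ι : Type*}
    (b : ι → EuclideanSpace ℝ (Fin n) × (EuclideanSpace ℝ (Fin n) →L[ℝ] ℝ))
    (u : ι → EuclideanSpace ℝ (Fin n)) :
    (of fun k j => cotangentToComplex (b k) j) * (complexFrameMatrix u)ᵀ =
      of fun k l => ((inner ℝ (b k).1 (u l) : ℝ) : ℂ) + Complex.I * (((b k).2 (u l) : ℝ) : ℂ) := by
  ext k l
  rw [Matrix.mul_apply]
  exact sum_cotangentToComplex_mul (b k) (u l)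

theorem det_ne_zero_of_orthonormal {u : Fin n → EuclideanSpace ℝ (Fin n)}
    (hu : Orthonormal ℝ u) : (of fun i j => u i j).det ≠ 0 := by
  intro h
  have hRR : (of fun i j => u i j) * (of fun i j => u i j)ᵀ = 1 := by
    ext i j
    rw [Matrix.mul_apply, Matrix.one_apply, ← orthonormal_iff_ite.1 hu i j, PiLp.inner_apply]
    refine Finset.sum_congr rfl fun k _ => ?_
    rw [RCLike.inner_apply, conj_trivial, mul_comm]
    rfl
  have := congrArg Matrix.det hRR
  rw [det_mul, h, zero_mul, det_one] at this
  exact zero_ne_one this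

/-- The value of `dz₁ ∧ ⋯ ∧ dzₙ` on the adapted frame is `± i^q det (I + i (A + B))`. -/
theorem exists_holomorphicVolumeForm_twistedFrame {p q : ℕ} {μ : OneFormOn L}
    (hμ : μ.IsSmooth) (hdμ : μ.IsClosedForm)
    (ν : EuclideanSpace ℝ (Fin n) → EuclideanSpace ℝ (Fin n))
    {x : EuclideanSpace ℝ (Fin n)} (hx : x ∈ L)
    (e : OrthonormalBasis (Fin p) ℝ (tangentSpaceAt L x))
    (f : OrthonormalBasis (Fin q) ℝ (tangentSpaceAt L x)ᗮ) (σ : Fin n ≃ Fin p ⊕ Fin q) :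
    ∃ d : ℝ, d ≠ 0 ∧
      (d : ℂ) * holomorphicVolumeForm (fun i => cotangentToComplex (twistedFrame μ ν e f (σ i))) =
        Complex.I ^ q *
          (onePlus Complex.I (secondFundamentalMatrix L ν e + μ.symCovDerivMatrix e)).det := by
  let u : Fin p ⊕ Fin q → EuclideanSpace ℝ (Fin n) :=
    Sum.elim (fun i => (e i : EuclideanSpace ℝ (Fin n))) (fun k => (f k : EuclideanSpace ℝ (Fin n)))
  have hee (i j : Fin p) : inner ℝ (e i : EuclideanSpace ℝ (Fin n)) (e j) =
      if i = j then (1 : ℝ) else 0 := orthonormal_iff_ite.1 e.orthonormal i j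
  have hff (i j : Fin q) : inner ℝ (f i : EuclideanSpace ℝ (Fin n)) (f j) =
      if i = j then (1 : ℝ) else 0 := orthonormal_iff_ite.1 f.orthonormal i j
  have hef (i : Fin p) (k : Fin q) :
      inner ℝ (e i : EuclideanSpace ℝ (Fin n)) (f k : EuclideanSpace ℝ (Fin n)) = 0 :=
    (Submodule.mem_orthogonal _ _).1 (f k).2 _ (e i).2
  have hfe (k : Fin q) (i : Fin p) :
      inner ℝ (f k : EuclideanSpace ℝ (Fin n)) (e i : EuclideanSpace ℝ (Fin n)) = 0 :=
    (Submodule.mem_orthogonal' _ _).1 (f k).2 _ (e i).2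
  let R : Matrix (Fin n) (Fin n) ℝ := of fun i j => u (σ i) j
  have huu (k l : Fin p ⊕ Fin q) : inner ℝ (u k) (u l) = if k = l then (1 : ℝ) else 0 := by
    rcases k with i | i <;> rcases l with j | j
    · simp only [u, Sum.elim_inl, hee, Sum.inl.injEq]
    · simp only [u, Sum.elim_inl, Sum.elim_inr, hef, reduceCtorEq, if_false]
    · simp only [u, Sum.elim_inl, Sum.elim_inr, hfe, reduceCtorEq, if_false]
    · simp only [u, Sum.elim_inr, hff, Sum.inr.injEq]
  have hR : R.det ≠ 0 :=
    det_ne_zero_of_orthonormal ((orthonormal_iff_ite.2 huu).comp σ σ.injective)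
  refine ⟨R.det, hR, ?_⟩
  let V : Matrix (Fin p ⊕ Fin q) (Fin n) ℂ :=
    of fun k j => cotangentToComplex (twistedFrame μ ν e f k) j
  have hQ : ((R.det : ℝ) : ℂ) = (((complexFrameMatrix u).submatrix σ id)ᵀ).det := by
    rw [det_transpose]
    exact RingHom.map_det Complex.ofRealHom R
  have hV : holomorphicVolumeForm (fun i => cotangentToComplex (twistedFrame μ ν e f (σ i))) =
      (V.submatrix σ id).det := rfl
  -- The rows of `(0, f_k)` pair to zero with `e` and to `i` times the identity with `f`. The upper
  -- right block does not affect the determinant.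
  have hblock : V * (complexFrameMatrix u)ᵀ =
      fromBlocks (onePlus Complex.I (secondFundamentalMatrix L ν e + μ.symCovDerivMatrix e))
        (of fun i k => Complex.I * ((μ.twistDeriv ν x (e i) (f k) : ℝ) : ℂ)) 0
        (Complex.I • (1 : Matrix (Fin q) (Fin q) ℂ)) := by
    rw [of_cotangentToComplex_mul_transpose]
    ext k l
    rcases k with i | k <;> rcases l with j | l
    · have h1 : μ.twistDeriv ν x (e i) (e j) =
          secondFundamentalMatrix L ν e i j + μ.symCovDerivMatrix e i j := by
        rw [OneFormOn.symCovDerivMatrix_apply hμ hdμ hx, OneFormOn.twistDeriv_apply]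
        rw [_root_.add_apply, rieszEquiv_apply]
        congr 1
        exact (Submodule.inner_orthogonalProjectionOnto_eq_of_mem_right (e j) _).symm
      simp [twistedFrame, u, h1, hee, onePlus, Matrix.one_apply, apply_ite Complex.ofReal]
    · simp [twistedFrame, u, hef]
    · simp [twistedFrame, u, hfe]
    · simp [twistedFrame, u, hff, Matrix.one_apply, apply_ite Complex.ofReal]
  have hmul : V.submatrix σ id * ((complexFrameMatrix u).submatrix σ id)ᵀ =
      (V * (complexFrameMatrix u)ᵀ).submatrix σ σ := by
    rw [transpose_submatrix]
    exact submatrix_mul_equiv V (complexFrameMatrix u)ᵀ σ (Equiv.refl _) σ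
  rw [hQ, hV, mul_comm, ← det_mul, hmul, det_submatrix_equiv_self, hblock,
    det_fromBlocks_zero₂₁, det_smul, det_one, mul_one, Fintype.card_fin, mul_comm]

/-- The phase condition on the tangent space of `X_μ` at `(x, ν_x + μ_x)`. -/
theorem forall_im_holomorphicVolumeForm_eq_zero_iff {p : ℕ} (hL : IsSmoothSubmanifold p L)
    {μ : OneFormOn L} (hμ : μ.IsSmooth) (hdμ : μ.IsClosedForm)
    {ν : EuclideanSpace ℝ (Fin n) → EuclideanSpace ℝ (Fin n)} (hν : IsNormalField L ν)
    {x : EuclideanSpace ℝ (Fin n)} (hx : x ∈ L)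
    (e : OrthonormalBasis (Fin p) ℝ (tangentSpaceAt L x)) (c : ℂ) :
    (∀ v : Fin n → EuclideanSpace ℂ (Fin n), (∀ i, v i ∈ tangentSpaceAt (twistedConormalComplex μ)
        (cotangentToComplex (x, rieszEquiv _ (ν x) + μ.ambient x))) →
        (c * holomorphicVolumeForm v).im = 0) ↔
      (c * (Complex.I ^ (n - p) *
        (onePlus Complex.I (secondFundamentalMatrix L ν e + μ.symCovDerivMatrix e)).det)).im
        = 0 := by
  have hrank := hL.finrank_tangentSpaceAt hx
  have hsum := (tangentSpaceAt L x).finrank_add_finrank_orthogonal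
  rw [finrank_euclideanSpace_fin, hrank] at hsum
  -- The natural subtraction is exact, since `hsum` forces `p ≤ n`.
  let f : OrthonormalBasis (Fin (n - p)) ℝ (tangentSpaceAt L x)ᗮ :=
    (stdOrthonormalBasis ℝ (tangentSpaceAt L x)ᗮ).reindex (finCongr (by omega))
  let σ : Fin n ≃ Fin p ⊕ Fin (n - p) := (finCongr (by omega)).trans finSumFinEquiv.symm
  obtain ⟨d, hd, hdet⟩ := exists_holomorphicVolumeForm_twistedFrame hμ hdμ ν hx e f σ
  have hmem (b : EuclideanSpace ℝ (Fin n) × (EuclideanSpace ℝ (Fin n) →L[ℝ] ℝ)) :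
      cotangentToComplex b ∈ tangentSpaceAt (twistedConormalComplex μ)
        (cotangentToComplex (x, rieszEquiv _ (ν x) + μ.ambient x)) ↔
      b ∈ tangentSpaceAt (twistedConormal μ) (x, rieszEquiv _ (ν x) + μ.ambient x) :=
    mem_tangentSpaceAt_image_iff cotangentToComplexEquiv
  rw [← hdet, mul_left_comm, Complex.im_ofReal_mul, mul_eq_zero, or_iff_right hd]
  constructor
  · exact fun h => h _ fun i => (hmem _).2 (twistedFrame_mem hL hμ hν hx e f (σ i))
  · intro h v hv
    have hex (i : Fin n) : ∃ r : Fin n → ℝ,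
        v i = ∑ k, r k • cotangentToComplex (twistedFrame μ ν e f (σ k)) := by
      obtain ⟨b, hb⟩ := cotangentToComplexEquiv.surjective (v i)
      have hbi := hv i
      rw [← hb, cotangentToComplexEquiv_apply, hmem] at hbi
      obtain ⟨r, hr⟩ := exists_eq_sum_twistedFrame hL hμ hν hx e f hbi
      refine ⟨r ∘ σ, ?_⟩
      rw [← hb, hr, map_sum, ← σ.sum_comp]
      simp only [map_smul, cotangentToComplexEquiv_apply, Function.comp_apply]
    choose r hr using hex
    -- A real change of vectors multiplies `Ω` by a real determinant, which preserves the vanishing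
    -- of the imaginary part.
    have hfac : holomorphicVolumeForm v = (((of r).det : ℝ) : ℂ) *
        holomorphicVolumeForm (fun i => cotangentToComplex (twistedFrame μ ν e f (σ i))) := by
      rw [show (((of r).det : ℝ) : ℂ) = ((of r).map Complex.ofReal).det from
        RingHom.map_det Complex.ofRealHom (of r), holomorphicVolumeForm, holomorphicVolumeForm,
        ← det_mul]
      congr 1
      ext i j
      simp [hr i, Matrix.mul_apply]
    rw [hfac, mul_left_comm, Complex.im_ofReal_mul, h, mul_zero]

theorem IsNormalField.const_smul {ν : EuclideanSpace ℝ (Fin n) → EuclideanSpace ℝ (Fin n)}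
    (hν : IsNormalField L ν) (t : ℝ) : IsNormalField L (fun y => t • ν y) := by
  refine ⟨fun x hx => ?_, fun x hx => Submodule.smul_mem _ _ (hν.2 x hx)⟩
  obtain ⟨U, N, hU, hxU, hN, hNL⟩ := hν.1 x hx
  exact ⟨U, fun y => t • N y, hU, hxU, (contDiff_const_smul t).comp_contDiffOn hN,
    fun y hy => by simp only [hNL y hy]⟩

theorem isNormalField_zero (L : Set (EuclideanSpace ℝ (Fin n))) :
    IsNormalField L (fun _ => 0) :=
  ⟨fun _ _ => ⟨Set.univ, _, isOpen_univ, trivial, contDiffOn_const, fun _ _ => rfl⟩,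
    fun _ _ => Submodule.zero_mem _⟩

theorem secondFundamentalMatrix_const_smul {p : ℕ}
    {ν : EuclideanSpace ℝ (Fin n) → EuclideanSpace ℝ (Fin n)} (hν : IsNormalField L ν)
    {x : EuclideanSpace ℝ (Fin n)} (hx : x ∈ L)
    (e : OrthonormalBasis (Fin p) ℝ (tangentSpaceAt L x)) (t : ℝ) :
    secondFundamentalMatrix L (fun y => t • ν y) e = t • secondFundamentalMatrix L ν e := by
  obtain ⟨U, N, hU, hxU, hN, hNL⟩ := hν.1 x hx
  have hNd := (hN.contDiffAt (hU.mem_nhds hxU)).differentiableAt (by simp)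
  ext i j
  have h1 : derivAlong L (fun y => t • ν y) x (e i) = t • derivAlong L ν x (e i) := by
    rw [derivAlong_eq_fderiv hx (hU.mem_nhds hxU) hNd hNL (e i).2,
      derivAlong_eq_fderiv hx (hU.mem_nhds hxU) (hNd.const_smul t)
        (fun y hy => by rw [hNL y hy]; rfl) (e i).2, fderiv_const_smul hNd]
    rfl
  simp [secondFundamentalMatrix, secondFundamentalForm, h1, inner_smul_left]

end Complex

/-! ### The main theorem. -/

theorem theorem2p2 (n p : ℕ) (L : Set (EuclideanSpace ℝ (Fin n))) (hL : IsSmoothSubmanifold p L)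
    (μ : OneFormOn L) (hμ : μ.IsSmooth) (hdμ : μ.IsClosedForm) (θ φ : ℝ)
    (hφ : φ = Real.pi / 2 * ((n : ℝ) - (p : ℝ)) - θ) :
    IsLagrangian (twistedConormalComplex μ) ∧
    (∀ x ∈ L, ∀ e : OrthonormalBasis (Fin p) ℝ (tangentSpaceAt L x), ∀ i j : Fin p,
      μ.symCovDerivMatrix e i j = μ.covDeriv x (e i) (e j)) ∧
    (IsSpecialLagrangian θ (twistedConormalComplex μ) ↔
      (∀ x ∈ L, ∀ e : OrthonormalBasis (Fin p) ℝ (tangentSpaceAt L x),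
        (Complex.exp (φ * Complex.I) *
          (onePlus Complex.I (μ.symCovDerivMatrix e)).det).im = 0) ∧
      ∀ ν : EuclideanSpace ℝ (Fin n) → EuclideanSpace ℝ (Fin n), IsNormalField L ν →
        ∀ x ∈ L, ∀ e : OrthonormalBasis (Fin p) ℝ (tangentSpaceAt L x), ∀ j ∈ Finset.Icc 1 p,
          matrixSigma j ((secondFundamentalMatrix L ν e).map Complex.ofReal *
              (onePlus Complex.I (μ.symCovDerivMatrix e))⁻¹) =
            (-1) ^ j * matrixSigma j ((secondFundamentalMatrix L ν e).map Complex.ofReal *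
              (onePlus (-Complex.I) (μ.symCovDerivMatrix e))⁻¹)) := by
  have hLag := isLagrangian_twistedConormalComplex hL hμ hdμ
  -- A point of `L` is needed for `p ≤ n`; for empty `L` the truncated `n - p` may differ from the
  -- real difference in `φ`.
  have hphase {x : EuclideanSpace ℝ (Fin n)} (hx : x ∈ L) :
      Complex.exp (-(θ * Complex.I)) * Complex.I ^ (n - p) = Complex.exp (φ * Complex.I) := by
    have hpn : p ≤ n := by
      have := (tangentSpaceAt L x).finrank_le
      rwa [hL.finrank_tangentSpaceAt hx, finrank_euclideanSpace_fin] at this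
    have hI : Complex.I ^ (n - p) =
        Complex.exp ((n - p : ℕ) * (Real.pi / 2 * Complex.I)) := by
      rw [Complex.exp_nat_mul, Complex.exp_pi_div_two_mul_I]
    rw [hI, ← Complex.exp_add, hφ]
    congr 1
    push_cast [Nat.cast_sub hpn]
    ring
  have hpt {ν : EuclideanSpace ℝ (Fin n) → EuclideanSpace ℝ (Fin n)} (hν : IsNormalField L ν)
      {x : EuclideanSpace ℝ (Fin n)} (hx : x ∈ L)
      (e : OrthonormalBasis (Fin p) ℝ (tangentSpaceAt L x)) :=
    forall_im_holomorphicVolumeForm_eq_zero_iff hL hμ hdμ hν hx e (Complex.exp (-(θ * Complex.I)))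
  have halg (ν : EuclideanSpace ℝ (Fin n) → EuclideanSpace ℝ (Fin n))
      {x : EuclideanSpace ℝ (Fin n)} (e : OrthonormalBasis (Fin p) ℝ (tangentSpaceAt L x)) :=
    forall_im_det_onePlus_eq_zero_iff (A := secondFundamentalMatrix L ν e)
      (μ.isSymm_symCovDerivMatrix e) (Complex.exp_ne_zero (φ * Complex.I))
  refine ⟨hLag, fun x hx e i j => μ.symCovDerivMatrix_apply hμ hdμ hx e i j, ?_, ?_⟩
  · rintro ⟨-, hSL⟩
    have hall {ν : EuclideanSpace ℝ (Fin n) → EuclideanSpace ℝ (Fin n)} (hν : IsNormalField L ν)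
        {x : EuclideanSpace ℝ (Fin n)} (hx : x ∈ L)
        (e : OrthonormalBasis (Fin p) ℝ (tangentSpaceAt L x)) :=
      -- All the points `(x, tν_x + μ_x)` lie in the fibre of `X_μ` over `x`, which supplies the
      -- condition for every real `t`.
      (halg ν e).1 fun t => by
        have h := (hpt (hν.const_smul t) hx e).1 (hSL _ ⟨_, (mem_twistedConormal_iff μ _).2
          ⟨hx, by
            rw [add_sub_cancel_right]
            exact rieszEquiv_mem_annihilator.2 ((hν.const_smul t).2 x hx)⟩, rfl⟩)
        rwa [← mul_assoc, hphase hx, secondFundamentalMatrix_const_smul hν hx] at h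
    -- The condition on `B` does not involve `ν`, so the zero field yields it.
    exact ⟨fun x hx e => (hall (isNormalField_zero L) hx e).1,
      fun ν hν x hx e => (hall hν hx e).2⟩
  · rintro ⟨h1, h2⟩
    refine ⟨hLag, ?_⟩
    rintro _ ⟨a, ha, rfl⟩
    obtain ⟨ν, hν, hνa⟩ := exists_isNormalField_of_mem_twistedConormal hL ha
    let e : OrthonormalBasis (Fin p) ℝ (tangentSpaceAt L a.1) :=
      (stdOrthonormalBasis ℝ (tangentSpaceAt L a.1)).reindex
        (finCongr (hL.finrank_tangentSpaceAt ha.1))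
    rw [hνa]
    refine (hpt hν ha.1 e).2 ?_
    -- For the converse, one basis and the value `t = 1` are enough, as `ν` already passes through
    -- the given point.
    have h := (halg ν e).2 ⟨h1 _ ha.1 e, h2 ν hν _ ha.1 e⟩ 1
    rwa [one_smul, ← hphase ha.1, mul_assoc] at h

end
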